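/- **Setting.** Let $N\in\mathbb N$, let $A\in M_N(\mathbb N)$ (entries $\ge 0$) and $B\in M_N(\{0,1\})$ be such that $A_{ij}=0$ implies $B_{ij}=0$. Let $E_A$ be the graph with vertices $1,\dots,N$ and edges $e_{i,j,m}$, $0\le m<A_{ij}$, with range $r(e_{i,j,m})=i$ and source $s(e_{i,j,m})=j$; put $\#(e_{i,j,m})=m$, $A(e_{i,j,m})=A_{ij}$, $B(e_{i,j,m})=B_{ij}$. A path $e_1e_2\cdots$ satisfies $s(e_l)=r(e_{l+1})$; $iE_A^*$ is the set of finite paths with range $i$. For each vertex $i$ the group $\mathbb Z=\{a_i^k\}$ acts on $iE_A^*$ by $a_i^k\cdot(e_{i,j,m}\nu)=e_{i,j,\hat m}\,(a_j^{\hat k}\cdot\nu)$, where $kB_{ij}+m=\hat kA_{ij}+\hat m$, $0\le\hat m<A_{ij}$, with restrictions $a_i^k|_{e_{i,j,m}}=a_j^{\hat k}$, extended to paths by $g|_{e\nu}=(g|_e)|_\nu$. Let $G_B$ be the quotient of the group bundle $\bigsqcup_i\mathbb Z$ by the kernel of this action, with the induced action and restrictions (the faithful Katsura–Exel–Pardo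 action $(G_B,E_A)$). It is *regular* if for every $g\in G_B$ there is $K$ such that $g\cdot\mu=\mu$ and $|\mu|\ge K$ imply that $g|_\mu$ is the unit at $s(\mu)$. Let $E_A^{-\infty}$ be the space of left-infinite paths $\mu=\cdots\mu_{-2}\mu_{-1}$ with the product topology. Write $\mu\sim_{ae}\nu$ if there are a finite $F\subseteq G_B$ and $(g_n)_{n<0}\subseteq F$ such that, for all $n<0$, $g_n$ has domain $r(\mu_n)$ and $g_n\cdot\mu_n\cdots\mu_{-1}=\nu_n\cdots\nu_{-1}$; the limit space is $\mathcal J_{G_B,E_A}=E_A^{-\infty}/\!\sim_{ae}$ with the quotient topology. **The map $\zeta_B$.** Let $M=\max_{i,j}A_{ij}$ and $R=M(N+1)$. For $t\in\{0,1\}$ let $\mathcal I^t(\mu)$ be the set of maximal non-empty (possibly infinite) intervals $I=[I^-,I^+]$ of negative integers with $B(\mu_j)=t$ for all $j\in I$; let $\mu_I$ be the word $(\mu_j)_{j\in I}$, reindexed so that its last letter has index $-1$. For a word $w=w_{-n}\cdots w_{-1}$, $1\le n\le\infty$, put $$\Omega(w)=\sum_{j=-n}^{-1}s(w_j)R^{j}+r(w_{-n})R^{-(n+1)},\qquad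 \theta^0(w)=\sum_{j=-n}^{-1}\frac{\#(w_j)}{\prod_{l=j}^{-1}(A(w_l)+1)},\qquad \theta^1(w)=\sum_{j=-n}^{-1}\frac{\#(w_j)}{\prod_{l=j}^{-1}A(w_l)}$$ (the term with $r(w_{-n})$ is absent if $n=\infty$), and $$\zeta_B(\mu)=\sum_{I\in\mathcal I^0(\mu)}R^{3I^+}\Omega(\mu_I)e^{2\pi i\theta^0(\mu_I)}+\sum_{I\in\mathcal I^1(\mu)}R^{3I^+}\Omega(\mu_I)e^{2\pi i\theta^1(\mu_I)} .$$ Let $B'$ be the matrix with $B'_{ij}=0$ if $a_i$ acts trivially on $iE_A^*$ and $B'_{ij}=B_{ij}$ otherwise (it gives the same faithful action), and let $\zeta_{B'}$ be defined as $\zeta_B$ with $B'$ in place of $B$. **Theorem.** Suppose that $(G_B,E_A)$ is regular. Then there is a continuous injection $\mathcal J_{G_B,E_A}\to\mathbb C$. Moreover, if $M\ge 2$, then: 1. for all $\mu,\nu\in E_A^{-\infty}$, $\zeta_B(\mu)=\zeta_B(\nu)$ if and only if $\mu\sim_{ae}\nu$; 2. $\zeta_{B'}$ descends to a continuous injection $\mathcal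 J_{G_B,E_A}\to\mathbb C$; 3. if $a_i$ acts non-trivially on $iE_A^*$ whenever $B_{ij}=1$ for some $j$ (so that $B'=B$), then $\zeta_B$ itself descends to a continuous injection $\mathcal J_{G_B,E_A}\to\mathbb C$. -/

import Mathlib

noncomputable section

namespace KEP

variable {N : ℕ}

/-! ### The graph of a matrix and its path spaces -/

/-- An edge `e_{i,j,m}` of the graph `E_A`, with range `i`, source `j` and label `0 ≤ m < A i j`. -/
@[ext] structure Edge (A : Matrix (Fin N) (Fin N) ℕ) where
  rng : Fin N
  src : Fin N
  num : Fin (A rng src)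

/-- `IsPathFrom v p`: the list `p = e₁ … eₙ` is a path of `E_A` with range `v`, that is
`r(e₁) = v` and `s(eᵢ) = r(eᵢ₊₁)`.  The empty list is the path of length zero at `v`. -/
def IsPathFrom {A : Matrix (Fin N) (Fin N) ℕ} : Fin N → List (Edge A) → Prop
  | _, [] => True
  | v, e :: p => e.rng = v ∧ IsPathFrom e.src p

/-- The set `v E_A^*` of finite paths with range `v`. -/
abbrev FinPath (A : Matrix (Fin N) (Fin N) ℕ) (v : Fin N) : Type :=
  {p : List (Edge A) // IsPathFrom v p}

/-- The source of the path `p` with range `v`. -/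
def srcOf {A : Matrix (Fin N) (Fin N) ℕ} : Fin N → List (Edge A) → Fin N
  | v, [] => v
  | _, e :: p => srcOf e.src p

instance (A : Matrix (Fin N) (Fin N) ℕ) : TopologicalSpace (Edge A) := ⊥

/-- The space `E_A^{-∞}` of left-infinite paths `… μ₋₃ μ₋₂ μ₋₁` with the product topology.  The
edge `μ₋₍ₖ₊₁₎` is stored at position `k : ℕ`, so the path condition `s(μ_j) = r(μ_{j+1})` reads
as below. -/
abbrev LeftPath (A : Matrix (Fin N) (Fin N) ℕ) : Type :=
  {x : ℕ → Edge A // ∀ k, (x (k + 1)).src = (x k).rng}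

/-- The finite path `μ₋₍ₙ₊₁₎ … μ₋₁`. -/
def seg {A : Matrix (Fin N) (Fin N) ℕ} (x : ℕ → Edge A) : ℕ → List (Edge A)
  | 0 => [x 0]
  | n + 1 => x (n + 1) :: seg x n

/-! ### The action of `ℤ × E_A^0` -/

/-- The edge `e_{i,j,m̂}` in `a_i^k · e_{i,j,m} = e_{i,j,m̂}`, where `k B + m = k̂ A + m̂` and
`0 ≤ m̂ < A`. -/
def edgeAct (A : Matrix (Fin N) (Fin N) ℕ) (B : Matrix (Fin N) (Fin N) ℤ) (k : ℤ) (e : Edge A) :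
    Edge A where
  rng := e.rng
  src := e.src
  num := ⟨((k * B e.rng e.src + (e.num : ℕ)) % (A e.rng e.src : ℤ)).toNat, by
    have h : (0 : ℤ) < A e.rng e.src := by exact_mod_cast e.num.pos
    have h1 := Int.emod_nonneg (k * B e.rng e.src + (e.num : ℕ)) h.ne'
    have h2 := Int.emod_lt_of_pos (k * B e.rng e.src + (e.num : ℕ)) h
    omega⟩

/-- The exponent `k̂` in `a_i^k |_{e_{i,j,m}} = a_j^k̂`. -/
def edgeRes (A : Matrix (Fin N) (Fin N) ℕ) (B : Matrix (Fin N) (Fin N) ℤ) (k : ℤ) (e : Edge A) :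
    ℤ :=
  (k * B e.rng e.src + (e.num : ℕ)) / (A e.rng e.src : ℤ)

/-- The action on finite paths: `g · (e ν) = (g · e) (g|_e · ν)`. -/
def pathAct (A : Matrix (Fin N) (Fin N) ℕ) (B : Matrix (Fin N) (Fin N) ℤ) :
    ℤ → List (Edge A) → List (Edge A)
  | _, [] => []
  | k, e :: p => edgeAct A B k e :: pathAct A B (edgeRes A B k e) p

/-- The restriction to finite paths: `g|_{e ν} = (g|_e)|_ν`. -/
def pathRes (A : Matrix (Fin N) (Fin N) ℕ) (B : Matrix (Fin N) (Fin N) ℤ) :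
    ℤ → List (Edge A) → ℤ
  | k, [] => k
  | k, e :: p => pathRes A B (edgeRes A B k e) p

section basic

variable (A : Matrix (Fin N) (Fin N) ℕ) (B : Matrix (Fin N) (Fin N) ℤ)

theorem edgeAct_add (k l : ℤ) (e : Edge A) :
    edgeAct A B (k + l) e = edgeAct A B k (edgeAct A B l e) := by
  have h : (0 : ℤ) < A e.rng e.src := by exact_mod_cast e.num.pos
  have h1 := Int.emod_nonneg (l * B e.rng e.src + (e.num : ℕ)) h.ne'
  refine Edge.ext rfl rfl (heq_of_eq (Fin.ext ?_))
  simp only [edgeAct]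
  rw [Int.toNat_of_nonneg h1, Int.add_emod_emod]
  congr 2
  ring

theorem edgeRes_add (k l : ℤ) (e : Edge A) :
    edgeRes A B (k + l) e = edgeRes A B k (edgeAct A B l e) + edgeRes A B l e := by
  have h : (0 : ℤ) < A e.rng e.src := by exact_mod_cast e.num.pos
  have h1 := Int.emod_nonneg (l * B e.rng e.src + (e.num : ℕ)) h.ne'
  simp only [edgeRes, edgeAct]
  rw [Int.toNat_of_nonneg h1, ← Int.add_mul_ediv_right _ _ h.ne']
  congr 1
  have := Int.emod_add_mul_ediv (l * B e.rng e.src + (e.num : ℕ)) (A e.rng e.src : ℤ)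
  linear_combination -this

theorem edgeAct_zero (e : Edge A) : edgeAct A B 0 e = e := by
  refine Edge.ext rfl rfl (heq_of_eq (Fin.ext ?_))
  have h : ((e.num : ℕ) : ℤ) < A e.rng e.src := by exact_mod_cast e.num.isLt
  simp only [edgeAct, zero_mul, zero_add]
  rw [Int.emod_eq_of_lt (by positivity) h]
  simp

theorem edgeRes_zero (e : Edge A) : edgeRes A B 0 e = 0 := by
  have h : ((e.num : ℕ) : ℤ) < A e.rng e.src := by exact_mod_cast e.num.isLt
  simp only [edgeRes, zero_mul, zero_add]
  exact Int.ediv_eq_zero_of_lt (by positivity) h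

theorem pathAct_add (p : List (Edge A)) : ∀ k l : ℤ,
    pathAct A B (k + l) p = pathAct A B k (pathAct A B l p) := by
  induction p with
  | nil => intro k l; rfl
  | cons e p ih => intro k l; simp [pathAct, edgeAct_add, edgeRes_add, ih]

theorem pathAct_zero (p : List (Edge A)) : pathAct A B 0 p = p := by
  induction p with
  | nil => rfl
  | cons e p ih => simp [pathAct, edgeAct_zero, edgeRes_zero, ih]

theorem pathAct_append (p q : List (Edge A)) : ∀ k : ℤ,
    pathAct A B k (p ++ q) = pathAct A B k p ++ pathAct A B (pathRes A B k p) q := by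
  induction p with
  | nil => intro k; rfl
  | cons e p ih => intro k; simp [pathAct, pathRes, ih]

theorem pathAct_length (p : List (Edge A)) : ∀ k : ℤ, (pathAct A B k p).length = p.length := by
  induction p with
  | nil => intro k; rfl
  | cons e p ih => intro k; simp [pathAct, ih]

variable {A}

theorem isPathFrom_pathAct (p : List (Edge A)) : ∀ (k : ℤ) (v : Fin N),
    IsPathFrom v p → IsPathFrom v (pathAct A B k p) := by
  induction p with
  | nil => intro k v _; trivial
  | cons e p ih => intro k v h; exact ⟨h.1, ih _ _ h.2⟩

theorem isPathFrom_append (p q : List (Edge A)) : ∀ v : Fin N,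
    IsPathFrom v p → IsPathFrom (srcOf v p) q → IsPathFrom v (p ++ q) := by
  induction p with
  | nil => intro v _ h; exact h
  | cons e p ih => intro v h h'; exact ⟨h.1, ih _ h.2 h'⟩

theorem isPathFrom_seg (x : LeftPath A) : ∀ n : ℕ, IsPathFrom (x.1 n).rng (seg x.1 n)
  | 0 => ⟨rfl, trivial⟩
  | n + 1 => ⟨rfl, by rw [x.2 n]; exact isPathFrom_seg x n⟩

end basic

/-- The homomorphism `φ` of `ℤ` (at the vertex `v`) into the length and path preserving bijections
of `v E_A^*`: the generator `a_v` is the integer `1`. -/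
def phi (A : Matrix (Fin N) (Fin N) ℕ) (B : Matrix (Fin N) (Fin N) ℤ) (v : Fin N) :
    Multiplicative ℤ →* Equiv.Perm (FinPath A v) where
  toFun k :=
    { toFun := fun p => ⟨pathAct A B k.toAdd p.1, isPathFrom_pathAct B _ _ _ p.2⟩
      invFun := fun p => ⟨pathAct A B (-k.toAdd) p.1, isPathFrom_pathAct B _ _ _ p.2⟩
      left_inv := fun p => Subtype.ext (by
        change pathAct A B (-k.toAdd) (pathAct A B k.toAdd p.1) = p.1
        rw [← pathAct_add, neg_add_cancel, pathAct_zero])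
      right_inv := fun p => Subtype.ext (by
        change pathAct A B k.toAdd (pathAct A B (-k.toAdd) p.1) = p.1
        rw [← pathAct_add, add_neg_cancel, pathAct_zero]) }
  map_one' := Equiv.ext fun p => Subtype.ext (pathAct_zero A B p.1)
  map_mul' k l := Equiv.ext fun p => Subtype.ext (pathAct_add A B p.1 k.toAdd l.toAdd)

/-! ### The faithful action `(G_B, E_A)` -/

/-- The isotropy group at `v` of the faithful quotient `G_B = (ℤ × E_A^0) / ker φ`.  Since the
action fixes ranges, `G_B` is the bundle of these groups. -/
abbrev GB (A : Matrix (Fin N) (Fin N) ℕ) (B : Matrix (Fin N) (Fin N) ℤ) (v : Fin N) : Type :=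
  Multiplicative ℤ ⧸ (phi A B v).ker

/-- The class of the generator `a_v` in `G_B`. -/
def gen (A : Matrix (Fin N) (Fin N) ℕ) (B : Matrix (Fin N) (Fin N) ℤ) (v : Fin N) : GB A B v :=
  QuotientGroup.mk (Multiplicative.ofAdd 1)

/-- The action `p ↦ g · p` of an element `g` of `G_B` with domain (and codomain) `v`. -/
def act {A : Matrix (Fin N) (Fin N) ℕ} {B : Matrix (Fin N) (Fin N) ℤ} {v : Fin N} (g : GB A B v) :
    Equiv.Perm (FinPath A v) :=
  QuotientGroup.kerLift (phi A B v) g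

theorem pathRes_mem {A : Matrix (Fin N) (Fin N) ℕ} {B : Matrix (Fin N) (Fin N) ℤ} {v : Fin N}
    (p : FinPath A v) {k l : ℤ}
    (h : ∀ q : List (Edge A), IsPathFrom v q → pathAct A B k q = pathAct A B l q)
    (q : List (Edge A)) (hq : IsPathFrom (srcOf v p.1) q) :
    pathAct A B (pathRes A B k p.1) q = pathAct A B (pathRes A B l p.1) q := by
  have h1 := h (p.1 ++ q) (isPathFrom_append p.1 q v p.2 hq)
  rw [pathAct_append, pathAct_append, h p.1 p.2] at h1
  exact List.append_cancel_left h1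

theorem mk_eq_mk_iff {A : Matrix (Fin N) (Fin N) ℕ} {B : Matrix (Fin N) (Fin N) ℤ} {v : Fin N}
    (k l : Multiplicative ℤ) :
    ((k : GB A B v) = (l : GB A B v)) ↔
      ∀ q : List (Edge A), IsPathFrom v q → pathAct A B k.toAdd q = pathAct A B l.toAdd q := by
  rw [QuotientGroup.eq, MonoidHom.mem_ker, map_mul, map_inv, inv_mul_eq_one]
  constructor
  · intro h q hq
    exact congrArg Subtype.val (DFunLike.congr_fun h (⟨q, hq⟩ : FinPath A v))
  · intro h
    exact Equiv.ext fun q => Subtype.ext (h q.1 q.2)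

/-- The restriction `g|_p` in `G_B`; its domain is the source of `p`. -/
def res {A : Matrix (Fin N) (Fin N) ℕ} {B : Matrix (Fin N) (Fin N) ℤ} {v : Fin N} (g : GB A B v)
    (p : FinPath A v) : GB A B (srcOf v p.1) :=
  Quotient.liftOn' g
    (fun k => QuotientGroup.mk (Multiplicative.ofAdd (pathRes A B k.toAdd p.1)))
    (fun k l h => (mk_eq_mk_iff _ _).2 fun q hq =>
      pathRes_mem p ((mk_eq_mk_iff (v := v) k l).1 (Quotient.sound' h)) q hq)

/-- Regularity of `(G_B, E_A)`: for every `g ∈ G_B` there is `K` such that `g · p = p` and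
`|p| ≥ K` imply that `g|_p` is the unit at the source of `p`. -/
def IsRegular (A : Matrix (Fin N) (Fin N) ℕ) (B : Matrix (Fin N) (Fin N) ℤ) : Prop :=
  ∀ (v : Fin N) (g : GB A B v), ∃ K : ℕ, ∀ p : FinPath A v,
    act g p = p → K ≤ p.1.length → res g p = 1

/-- The groupoid `G_B` as a set: the disjoint union of its isotropy groups.  The domain of `g` is
`g.1`. -/
abbrev Total (A : Matrix (Fin N) (Fin N) ℕ) (B : Matrix (Fin N) (Fin N) ℤ) : Type :=
  Σ v : Fin N, GB A B v

/-- `Moves g p q`: `p` is a path whose range is the domain of `g`, and `g · p = q`. -/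
def Moves {A : Matrix (Fin N) (Fin N) ℕ} {B : Matrix (Fin N) (Fin N) ℤ} (g : Total A B)
    (p q : List (Edge A)) : Prop :=
  ∃ h : IsPathFrom g.1 p, (act g.2 ⟨p, h⟩).1 = q

/-- Asymptotic equivalence of left-infinite paths: there are a finite set `F ⊆ G_B` and a sequence
`(gₙ)` in `F` with `gₙ · μ₋₍ₙ₊₁₎ … μ₋₁ = ν₋₍ₙ₊₁₎ … ν₋₁` for all `n`. -/
def AsympEquiv (A : Matrix (Fin N) (Fin N) ℕ) (B : Matrix (Fin N) (Fin N) ℤ) (x y : LeftPath A) :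
    Prop :=
  ∃ F : Set (Total A B), F.Finite ∧ ∃ g : ℕ → Total A B, (∀ n, g n ∈ F) ∧
    ∀ n, Moves (g n) (seg x.1 n) (seg y.1 n)

theorem seg_ne_nil {A : Matrix (Fin N) (Fin N) ℕ} (x : ℕ → Edge A) (n : ℕ) : seg x n ≠ [] := by
  cases n <;> simp [seg]

theorem isPathFrom_unique {A : Matrix (Fin N) (Fin N) ℕ} {p : List (Edge A)} {v w : Fin N}
    (hp : p ≠ []) (hv : IsPathFrom v p) (hw : IsPathFrom w p) : v = w := by
  cases p with
  | nil => exact absurd rfl hp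
  | cons e p => exact hv.1.symm.trans hw.1

theorem asympEquiv_equivalence (A : Matrix (Fin N) (Fin N) ℕ) (B : Matrix (Fin N) (Fin N) ℤ) :
    Equivalence (AsympEquiv A B) where
  refl x := by
    refine ⟨Set.range fun v : Fin N => (⟨v, 1⟩ : Total A B), Set.finite_range _,
      fun n => ⟨(x.1 n).rng, 1⟩, fun n => ⟨_, rfl⟩, fun n => ⟨isPathFrom_seg x n, ?_⟩⟩
    simp [act]
  symm := by
    rintro x y ⟨F, hF, g, hg, hm⟩
    refine ⟨(fun t : Total A B => (⟨t.1, t.2⁻¹⟩ : Total A B)) '' F, hF.image _,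
      fun n => ⟨(g n).1, (g n).2⁻¹⟩, fun n => ⟨g n, hg n, rfl⟩, fun n => ?_⟩
    obtain ⟨h, he⟩ := hm n
    refine ⟨he ▸ (act (g n).2 ⟨_, h⟩).2, ?_⟩
    have : (⟨seg y.1 n, he ▸ (act (g n).2 ⟨_, h⟩).2⟩ : FinPath A (g n).1)
        = act (g n).2 ⟨_, h⟩ := Subtype.ext he.symm
    change (act ((g n).2⁻¹) ⟨seg y.1 n, _⟩).1 = _
    rw [this]
    simp [act]
  trans := by
    rintro x y z ⟨F, hF, g, hg, hm⟩ ⟨F', hF', g', hg', hm'⟩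
    have key : ∀ n, ∃ t : Total A B,
        t ∈ (⋃ v : Fin N, Sigma.mk v '' (Set.image2 (fun b a => b * a)
          (Sigma.mk v ⁻¹' F') (Sigma.mk v ⁻¹' F))) ∧ Moves t (seg x.1 n) (seg z.1 n) := by
      intro n
      have ha := hg n
      have hb := hg' n
      have h1 := hm n
      have h2 := hm' n
      generalize g n = a at ha h1
      generalize g' n = b at hb h2
      obtain ⟨v, a⟩ := a
      obtain ⟨w, b⟩ := b
      obtain ⟨h, he⟩ := h1
      obtain ⟨h', he'⟩ := h2
      have hy : IsPathFrom v (seg y.1 n) := he ▸ (act a ⟨_, h⟩).2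
      obtain rfl : v = w := isPathFrom_unique (seg_ne_nil _ _) hy h'
      refine ⟨⟨v, b * a⟩, Set.mem_iUnion.2 ⟨v, b * a, ⟨b, hb, a, ha, rfl⟩, rfl⟩, h, ?_⟩
      have : (⟨seg y.1 n, h'⟩ : FinPath A v) = act a ⟨_, h⟩ := Subtype.ext he.symm
      rw [← he', this]
      simp [act]
    choose t ht hmt using key
    refine ⟨_, Set.finite_iUnion fun v => ?_, t, ht, hmt⟩
    exact ((hF'.preimage sigma_mk_injective.injOn).image2 _
      (hF.preimage sigma_mk_injective.injOn)).image _

/-- Asymptotic equivalence as a setoid. -/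
def aeSetoid (A : Matrix (Fin N) (Fin N) ℕ) (B : Matrix (Fin N) (Fin N) ℤ) : Setoid (LeftPath A) :=
  ⟨AsympEquiv A B, asympEquiv_equivalence A B⟩

/-- The limit space `J_{G_B,E_A} = E_A^{-∞} / ∼_ae` with the quotient topology. -/
abbrev LimitSpace (A : Matrix (Fin N) (Fin N) ℕ) (B : Matrix (Fin N) (Fin N) ℤ) : Type :=
  Quotient (aeSetoid A B)

/-! ### The map `ζ` -/

/-- The largest entry `M` of `A` (zero for the empty matrix). -/
def maxEntry (A : Matrix (Fin N) (Fin N) ℕ) : ℕ :=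
  Finset.univ.sup fun ij : Fin N × Fin N => A ij.1 ij.2

/-- `R = M (N + 1)`. -/
def bigR (A : Matrix (Fin N) (Fin N) ℕ) : ℝ := (maxEntry A : ℝ) * ((N : ℝ) + 1)

/-- `Ω(w) = ∑_{j=-1}^{-n} s(w_j) R^j + r(w_{-n}) R^{-(n+1)}` for a word `w = w_{-n} … w_{-1}` of
length `n ≥ 1`, where `w_{-(k+1)}` is stored at position `k`; for `n = ∞` the last term is absent.
The vertices are numbered `1, …, N`. -/
def Omega {A : Matrix (Fin N) (Fin N) ℕ} (w : ℕ → Edge A) (n : ℕ∞) : ℝ :=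
  (∑' k : ℕ, if (k : ℕ∞) < n then (((w k).src : ℕ) + 1 : ℝ) / bigR A ^ (k + 1) else 0) +
    if n = ⊤ then 0 else (((w (n.toNat - 1)).rng : ℕ) + 1 : ℝ) / bigR A ^ (n.toNat + 1)

/-- `∑_{j=-1}^{-n} #(w_j) / ∏_{i=j}^{-1} c(w_i)` for a word `w` of length `n` as above. -/
def thetaSum {A : Matrix (Fin N) (Fin N) ℕ} (c : Edge A → ℝ) (w : ℕ → Edge A) (n : ℕ∞) : ℝ :=
  ∑' k : ℕ, if (k : ℕ∞) < n then
    ((w k).num : ℕ) / ∏ i ∈ Finset.range (k + 1), c (w i) else (0 : ℝ)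

/-- `θ⁰`: the expansion with bases `A(e) + 1`. -/
def theta0 {A : Matrix (Fin N) (Fin N) ℕ} : (ℕ → Edge A) → ℕ∞ → ℝ :=
  thetaSum fun e => (A e.rng e.src : ℝ) + 1

/-- `θ¹`: the expansion with bases `A(e)`. -/
def theta1 {A : Matrix (Fin N) (Fin N) ℕ} : (ℕ → Edge A) → ℕ∞ → ℝ :=
  thetaSum fun e => (A e.rng e.src : ℝ)

/-- The pair `(a, n)` with `n ∈ {1, 2, …, ∞}` stands for the interval of the positions `k` with
`a ≤ k < a + n`, that is for `I = [-(a+n), -(a+1)]`, with `I⁺ = -(a+1)`.  It belongs to `𝓘ᵗ(μ)` if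
`B(μ_j) = t` for all `j ∈ I` and `I` is maximal with this property. -/
def IsTypeInterval {A : Matrix (Fin N) (Fin N) ℕ} (B : Matrix (Fin N) (Fin N) ℤ) (x : LeftPath A)
    (t : ℤ) (I : ℕ × ℕ∞) : Prop :=
  1 ≤ I.2 ∧
  (∀ k : ℕ, I.1 ≤ k → (k : ℕ∞) < I.1 + I.2 → B (x.1 k).rng (x.1 k).src = t) ∧
  (∀ k : ℕ, k + 1 = I.1 → B (x.1 k).rng (x.1 k).src ≠ t) ∧
  (∀ k : ℕ, (k : ℕ∞) = I.1 + I.2 → B (x.1 k).rng (x.1 k).src ≠ t)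

/-- The word `μ_I`, to be read with the length of `I`. -/
def subword {A : Matrix (Fin N) (Fin N) ℕ} (x : LeftPath A) (I : ℕ × ℕ∞) : ℕ → Edge A :=
  fun k => x.1 (I.1 + k)

/-- `ζ(μ) = ∑_{I ∈ 𝓘⁰(μ)} R^{3I⁺} Ω(μ_I) e^{2πiθ⁰(μ_I)} + ∑_{I ∈ 𝓘¹(μ)} R^{3I⁺} Ω(μ_I) e^{2πiθ¹(μ_I)}`,
the intervals being formed with respect to `B`. -/
def zeta (A : Matrix (Fin N) (Fin N) ℕ) (B : Matrix (Fin N) (Fin N) ℤ) (x : LeftPath A) : ℂ :=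
  (∑' I : {I : ℕ × ℕ∞ // IsTypeInterval B x 0 I},
    ((Omega (subword x I.1) I.1.2 / bigR A ^ (3 * (I.1.1 + 1)) : ℝ) : ℂ) *
      Complex.exp (2 * Real.pi * Complex.I * (theta0 (subword x I.1) I.1.2 : ℝ))) +
  ∑' I : {I : ℕ × ℕ∞ // IsTypeInterval B x 1 I},
    ((Omega (subword x I.1) I.1.2 / bigR A ^ (3 * (I.1.1 + 1)) : ℝ) : ℂ) *
      Complex.exp (2 * Real.pi * Complex.I * (theta1 (subword x I.1) I.1.2 : ℝ))

open Classical in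
/-- The reduced matrix: the rows of `B` at those vertices `i` whose generator `a_i` acts trivially
on `i E_A^*` are replaced by zero.  This does not change the faithful action. -/
def reduced (A : Matrix (Fin N) (Fin N) ℕ) (B : Matrix (Fin N) (Fin N) ℤ) :
    Matrix (Fin N) (Fin N) ℤ :=
  fun i j => if gen A B i = 1 then 0 else B i j

end KEP

end

/-! Regroup ζ by positions: a maximal interval ending at position `a` contributes Ω e^{2πiθ} /
R^{3(a+1)}, and ζ is the sum of these contributions over all `a` (`zeta_eq`). Since M ≥ 2, R ≥
2(N+1), so Ω, a base-R expansion with digits at most N, lies in [1/R, 1/2] and determines its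
digits. The weights R^{-3(a+1)} decay so fast that the intervals further left are a small error when
the last interval is being read off.

Equal values give equivalent paths (`asympEquiv_of_tsum_term_eq`). The modulus of the leading term
is Ω, so the error bound forces the same vertices and the same length for the last interval
(`vertexDigit_eq`). If that interval is finite, its phases are roots of unity of a common order too
well separated to be confused, so the labels agree, and the interval is stripped off. If it is
infinite there is no error and θ agrees modulo 1. For type 0 the bases A(e) + 1 exclude the
ambiguity of expansions, so the labels agree; for type 1 the ambiguity remains, and it is exactly
the action of one of the integers -1, 0, 1, because a path of type 1 is an odometer.

Equivalent paths have equal values (`AsympEquiv.tsum_term_eq`). The action preserves vertices, and a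
type 0 edge is fixed and kills the restriction, so everything to its right agrees. Labels can change
only in an infinite interval of type 1, where truncations differ by bounded integers modulo the
product P of the sizes. If P tends to infinity, θ agrees modulo 1. Otherwise sizes are eventually 1
and, by pigeonhole, there is a cycle with all sizes 1; regularity makes the generators on it
trivial, and triviality propagates to the right and forces every size to be 1, so that all labels
vanish (`Absorbs.dichotomy`).

For B' the second alternative disappears, because rows of trivial generators are zero
(`IsRegular.absorbs_reduced`). Then P tends to infinity along every infinite interval, which makes θ
continuous. If M ≤ 1, equivalence is equality, and the sequence of vertices gives the embedding. -/

noncomputable section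

namespace KEP

/-! ### Expansions in a fixed base -/

/-- The number with digits `d 0, d 1, …` after the point in base `R`. -/
def digitSum (R : ℝ) (d : ℕ → ℕ) : ℝ := ∑' k, (d k : ℝ) / R ^ (k + 1)

section digitSum

variable {R : ℝ} {n : ℕ} {d d' : ℕ → ℕ}

theorem summable_const_div_pow (hR : 1 < R) (c : ℝ) : Summable fun k : ℕ => c / R ^ (k + 1) := by
  have h : Summable fun k : ℕ => R⁻¹ ^ k :=
    summable_geometric_of_lt_one (by positivity) (inv_lt_one_of_one_lt₀ hR)
  refine (h.mul_left (c * R⁻¹)).congr fun k => ?_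
  rw [div_eq_mul_inv, ← inv_pow, pow_succ]
  ring

theorem tsum_const_div_pow (hR : 1 < R) (c : ℝ) : ∑' k : ℕ, c / R ^ (k + 1) = c / (R - 1) := by
  have h1 : ∀ k : ℕ, c / R ^ (k + 1) = c * R⁻¹ * R⁻¹ ^ k := fun k => by
    rw [div_eq_mul_inv, ← inv_pow, pow_succ]
    ring
  simp_rw [h1]
  rw [tsum_mul_left, tsum_geometric_of_lt_one (by positivity) (inv_lt_one_of_one_lt₀ hR)]
  have : R - 1 ≠ 0 := by linarith
  have : R ≠ 0 := by linarith
  field_simp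

theorem summable_digits (hR : 1 < R) (hd : ∀ k, d k ≤ n) :
    Summable fun k => (d k : ℝ) / R ^ (k + 1) := by
  have : 0 < R := by linarith
  refine Summable.of_nonneg_of_le (fun k => by positivity) (fun k => ?_)
    (summable_const_div_pow hR (n : ℝ))
  have := hd k
  gcongr

theorem digitSum_nonneg (hR : 1 < R) : 0 ≤ digitSum R d :=
  tsum_nonneg fun k => by
    have : 0 < R := by linarith
    positivity

theorem digitSum_le (hR : 2 * (n + 1) ≤ R) (hd : ∀ k, d k ≤ n) : digitSum R d ≤ 1 / 2 := by
  have hn : (0 : ℝ) ≤ n := by positivity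
  have h1 : 1 < R := by linarith
  have h0 : 0 < R := by linarith
  calc digitSum R d ≤ ∑' k : ℕ, (n : ℝ) / R ^ (k + 1) :=
        (summable_digits h1 hd).tsum_le_tsum (fun k => by have := hd k; gcongr)
          (summable_const_div_pow h1 _)
    _ = n / (R - 1) := tsum_const_div_pow h1 _
    _ ≤ 1 / 2 := by rw [div_le_div_iff₀ (by linarith) (by norm_num)]; linarith

theorem digitSum_split (hR : 1 < R) (hd : ∀ k, d k ≤ n) (m : ℕ) :
    digitSum R d = ∑ k ∈ Finset.range m, (d k : ℝ) / R ^ (k + 1)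
      + digitSum R (fun k => d (k + m)) / R ^ m := by
  have h0 : R ≠ 0 := by linarith
  rw [digitSum, ← (summable_digits hR hd).sum_add_tsum_nat_add m, digitSum, ← tsum_div_const]
  congr 1
  refine tsum_congr fun k => ?_
  rw [div_div, ← pow_add]
  congr 2
  ring

/-- At the first differing digit the gap is at least one unit, and the tail of the smaller number
can only win back part of it; the tail of the larger one is dropped. -/
theorem digitSum_lower (hR : 2 * (n + 1) ≤ R) (hd : ∀ k, d k ≤ n) (hd' : ∀ k, d' k ≤ n) {m : ℕ}
    (heq : ∀ k < m, d k = d' k) (hlt : d m < d' m) :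
    (1 - digitSum R fun k => d (k + (m + 1))) / R ^ (m + 1) ≤ digitSum R d' - digitSum R d := by
  have hn : (0 : ℝ) ≤ n := by positivity
  have h1 : 1 < R := by linarith
  have h0 : 0 < R := by linarith
  rw [digitSum_split h1 hd (m + 1), digitSum_split h1 hd' (m + 1), Finset.sum_range_succ,
    Finset.sum_range_succ]
  have h4 : ∑ k ∈ Finset.range m, (d k : ℝ) / R ^ (k + 1)
      = ∑ k ∈ Finset.range m, (d' k : ℝ) / R ^ (k + 1) :=
    Finset.sum_congr rfl fun k hk => by rw [heq k (Finset.mem_range.1 hk)]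
  have h2 : (0 : ℝ) ≤ digitSum R (fun k => d' (k + (m + 1))) / R ^ (m + 1) :=
    div_nonneg (digitSum_nonneg h1) (by positivity)
  have h3 : (d m : ℝ) / R ^ (m + 1) + 1 / R ^ (m + 1) ≤ d' m / R ^ (m + 1) := by
    rw [← add_div]
    have : (d m : ℝ) + 1 ≤ d' m := by exact_mod_cast hlt
    gcongr
  rw [sub_div]
  linarith

theorem digitSum_lower_half (hR : 2 * (n + 1) ≤ R) (hd : ∀ k, d k ≤ n) (hd' : ∀ k, d' k ≤ n)
    {m : ℕ} (heq : ∀ k < m, d k = d' k) (hlt : d m < d' m) :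
    1 / 2 / R ^ (m + 1) ≤ digitSum R d' - digitSum R d := by
  refine le_trans ?_ (digitSum_lower hR hd hd' heq hlt)
  have := digitSum_le hR fun k => hd (k + (m + 1))
  have hn : (0 : ℝ) ≤ n := by positivity
  have h0 : 0 < R := by linarith
  gcongr
  linarith

/-- When the smaller expansion stops at position `m`, no part of the unit is lost. The constant 1
instead of 1/2 is needed in `not_vertexDigit_lt`. -/
theorem digitSum_lower_one (hR : 2 * (n + 1) ≤ R) (hd : ∀ k, d k ≤ n) (hd' : ∀ k, d' k ≤ n)
    {m : ℕ} (heq : ∀ k < m, d k = d' k) (hlt : d m < d' m) (hz : ∀ k, m < k → d k = 0) :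
    1 / R ^ (m + 1) ≤ digitSum R d' - digitSum R d := by
  refine le_trans (le_of_eq ?_) (digitSum_lower hR hd hd' heq hlt)
  have : digitSum R (fun k => d (k + (m + 1))) = 0 := by
    rw [digitSum]
    simp [fun k => hz (k + (m + 1)) (by omega)]
  rw [this, sub_zero]

theorem digitSum_injective (hR : 2 * (n + 1) ≤ R) (hd : ∀ k, d k ≤ n) (hd' : ∀ k, d' k ≤ n)
    (h : digitSum R d = digitSum R d') : d = d' := by
  have hn : (0 : ℝ) ≤ n := by positivity
  have h0 : 0 < R := by linarith
  funext m
  induction m using Nat.strong_induction_on with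
  | _ m ih =>
    have hp : 0 < 1 / 2 / R ^ (m + 1) := by positivity
    rcases lt_trichotomy (d m) (d' m) with h1 | h1 | h1
    · have := digitSum_lower_half hR hd hd' ih h1
      linarith
    · exact h1
    · have := digitSum_lower_half hR hd' hd (fun k hk => (ih k hk).symm) h1
      linarith

end digitSum

/-! ### Expansions in a mixed base -/

/-- The product of the first `n` bases. -/
def radixProd (c : ℕ → ℕ) (n : ℕ) : ℕ := ∏ i ∈ Finset.range n, c i

/-- The integer with the digits `d 0, …, d (n - 1)`, the most significant one first, in the mixed
base `c`. -/
def radixVal (d c : ℕ → ℕ) : ℕ → ℕ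
  | 0 => 0
  | n + 1 => radixVal d c n * c n + d n

/-- The number with digits `d 0, d 1, …` after the point in the mixed base `c`. -/
def radixSum (d c : ℕ → ℕ) : ℝ := ∑' k, (d k : ℝ) / radixProd c (k + 1)

section radix

variable {d d' c : ℕ → ℕ}

theorem radixProd_succ (c : ℕ → ℕ) (n : ℕ) : radixProd c (n + 1) = radixProd c n * c n :=
  Finset.prod_range_succ _ _

theorem radixProd_zero (c : ℕ → ℕ) : radixProd c 0 = 1 := Finset.prod_range_zero _

theorem radixProd_pos (h : ∀ k, d k < c k) (n : ℕ) : 0 < radixProd c n :=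
  Finset.prod_pos fun k _ => (Nat.zero_le _).trans_lt (h k)

theorem radixVal_lt (h : ∀ k, d k < c k) (n : ℕ) : radixVal d c n < radixProd c n := by
  induction n with
  | zero => simp [radixVal, radixProd]
  | succ n ih =>
    rw [radixProd_succ, radixVal]
    have := h n
    nlinarith [Nat.mul_le_mul_right (c n) ih]

theorem radixVal_congr {c' : ℕ → ℕ} {n : ℕ} (hd : ∀ k < n, d k = d' k) (hc : ∀ k < n, c k = c' k) :
    radixVal d c n = radixVal d' c' n := by
  induction n with
  | zero => rfl
  | succ n ih =>
    rw [radixVal, radixVal, ih (fun k hk => hd k (by omega)) (fun k hk => hc k (by omega)),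
      hd n (by omega), hc n (by omega)]

theorem radixProd_congr {c' : ℕ → ℕ} {n : ℕ} (hc : ∀ k < n, c k = c' k) :
    radixProd c n = radixProd c' n :=
  Finset.prod_congr rfl fun k hk => hc k (Finset.mem_range.1 hk)

theorem sum_radix (h : ∀ k, d k < c k) (n : ℕ) :
    ∑ k ∈ Finset.range n, (d k : ℝ) / radixProd c (k + 1) = radixVal d c n / radixProd c n := by
  induction n with
  | zero => simp [radixVal]
  | succ n ih =>
    have h1 : (radixProd c n : ℝ) ≠ 0 := by exact_mod_cast (radixProd_pos h n).ne'
    have h2 : (c n : ℝ) ≠ 0 := by exact_mod_cast ((Nat.zero_le _).trans_lt (h n)).ne'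
    rw [Finset.sum_range_succ, ih, radixProd_succ, radixVal]
    push_cast
    field_simp

theorem sum_radix_le (h : ∀ k, d k < c k) (n : ℕ) :
    ∑ k ∈ Finset.range n, (d k : ℝ) / radixProd c (k + 1) ≤ 1 := by
  rw [sum_radix h]
  exact div_le_one_of_le₀ (by exact_mod_cast (radixVal_lt h n).le) (by positivity)

theorem summable_radix (h : ∀ k, d k < c k) : Summable fun k => (d k : ℝ) / radixProd c (k + 1) :=
  summable_of_sum_range_le (fun k => by positivity) (sum_radix_le h)

theorem tendsto_radix (h : ∀ k, d k < c k) :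
    Filter.Tendsto (fun n => (radixVal d c n : ℝ) / radixProd c n) Filter.atTop
      (nhds (radixSum d c)) := by
  simpa only [sum_radix h, radixSum] using (summable_radix h).hasSum.tendsto_sum_nat

theorem radixSum_nonneg : 0 ≤ radixSum d c := tsum_nonneg fun k => by positivity

theorem radixSum_le_one (h : ∀ k, d k < c k) : radixSum d c ≤ 1 :=
  Real.tsum_le_of_sum_range_le (fun k => by positivity) (sum_radix_le h)

theorem radixProd_add (c : ℕ → ℕ) (m n : ℕ) :
    radixProd c (m + n) = radixProd c m * radixProd (fun k => c (m + k)) n :=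
  Finset.prod_range_add _ _ _

theorem radixSum_split (h : ∀ k, d k < c k) (n : ℕ) :
    radixSum d c * radixProd c n
      = radixVal d c n + radixSum (fun k => d (n + k)) (fun k => c (n + k)) := by
  have h1 : (radixProd c n : ℝ) ≠ 0 := by exact_mod_cast (radixProd_pos h n).ne'
  rw [radixSum, ← (summable_radix h).sum_add_tsum_nat_add n, sum_radix h, add_mul,
    div_mul_cancel₀ _ h1, radixSum, ← tsum_mul_right]
  congr 1
  refine tsum_congr fun k => ?_
  rw [show k + n + 1 = n + (k + 1) by ring, radixProd_add, Nat.cast_mul, add_comm k n]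
  field_simp

/-- Multiplying by the product of the first `n` bases moves the point behind the first `n` digits,
and the remaining tail lies in [0, 1]. This turns statements on real expansions into statements on
integers. -/
theorem radixSum_bounds (h : ∀ k, d k < c k) (n : ℕ) :
    (radixVal d c n : ℝ) ≤ radixSum d c * radixProd c n ∧
      radixSum d c * radixProd c n ≤ radixVal d c n + 1 := by
  rw [radixSum_split h n]
  have h1 := radixSum_nonneg (d := fun k => d (n + k)) (c := fun k => c (n + k))
  have h2 := radixSum_le_one (d := fun k => d (n + k)) (c := fun k => c (n + k)) fun k => h (n + k)
  constructor <;> linarith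

theorem radixSum_of_finite (h : ∀ k, d k < c k) {n : ℕ} (hz : ∀ k, n ≤ k → d k = 0) :
    radixSum d c = radixVal d c n / radixProd c n := by
  rw [radixSum, tsum_eq_sum (s := Finset.range n), sum_radix h]
  intro k hk
  rw [hz k (by simpa using hk)]
  simp

theorem radixSum_lt_one_of_finite (h : ∀ k, d k < c k) {n : ℕ} (hz : ∀ k, n ≤ k → d k = 0) :
    radixSum d c < 1 := by
  rw [radixSum_of_finite h hz, div_lt_one (by exact_mod_cast radixProd_pos h n)]
  exact_mod_cast radixVal_lt h n

theorem radixSum_cons (h : ∀ k, d k < c k) :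
    radixSum d c * c 0 = d 0 + radixSum (fun k => d (k + 1)) (fun k => c (k + 1)) := by
  have := radixSum_split h 1
  simpa [radixVal, radixProd, add_comm 1] using this

/-- A value 1 needs the maximal digit throughout, the analogue of 0.999…; here no digit is maximal.
-/
theorem radixSum_lt_one_of_gap (h : ∀ k, d k + 1 < c k) : radixSum d c < 1 := by
  have h' : ∀ k, d k < c k := fun k => by have := h k; omega
  have h1 := radixSum_cons h'
  have h2 := radixSum_le_one (d := fun k => d (k + 1)) (c := fun k => c (k + 1)) fun k => h' (k + 1)
  have h3 : (d 0 : ℝ) + 1 < c 0 := by exact_mod_cast h 0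
  have h4 : (0 : ℝ) ≤ d 0 := by positivity
  by_contra! h5
  nlinarith

/-- If all tails are below 1, the first digit is the integer part of the value times the first base;
remove it and repeat. -/
theorem radixSum_injective {d d' c : ℕ → ℕ} (h : ∀ k, d k < c k) (h' : ∀ k, d' k < c k)
    (ht : ∀ n, radixSum (fun k => d (k + n)) (fun k => c (k + n)) < 1)
    (ht' : ∀ n, radixSum (fun k => d' (k + n)) (fun k => c (k + n)) < 1)
    (he : radixSum d c = radixSum d' c) : d = d' := by
  funext k
  have key : ∀ {d d' c : ℕ → ℕ}, (∀ k, d k < c k) → (∀ k, d' k < c k) →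
      radixSum (fun k => d (k + 1)) (fun k => c (k + 1)) < 1 →
      radixSum (fun k => d' (k + 1)) (fun k => c (k + 1)) < 1 →
      radixSum d c = radixSum d' c → d 0 ≤ d' 0 := by
    intro d d' c h h' h1 h2 he
    have e1 := radixSum_cons h
    have e2 := radixSum_cons h'
    have p1 := radixSum_nonneg (d := fun k => d (k + 1)) (c := fun k => c (k + 1))
    by_contra! hlt
    have : (d' 0 : ℝ) + 1 ≤ d 0 := by exact_mod_cast hlt
    rw [he] at e1
    linarith
  induction k generalizing d d' c with
  | zero => exact le_antisymm (key h h' (ht 1) (ht' 1) he) (key h' h (ht' 1) (ht 1) he.symm)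
  | succ k ih =>
    have h0 := le_antisymm (key h h' (ht 1) (ht' 1) he) (key h' h (ht' 1) (ht 1) he.symm)
    refine ih (d := fun k => d (k + 1)) (d' := fun k => d' (k + 1)) (c := fun k => c (k + 1))
      (fun k => h _) (fun k => h' _) (fun n => ?_) (fun n => ?_) ?_
    · simpa only [add_assoc] using ht (n + 1)
    · simpa only [add_assoc] using ht' (n + 1)
    · have e1 := radixSum_cons h
      have e2 := radixSum_cons h'
      rw [he, h0] at e1
      linarith

end radix

/-! ### Separation on the unit circle -/

/-- The point `e^{2πit}` of the unit circle. -/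
def circ (t : ℝ) : ℂ := Complex.exp (2 * Real.pi * Complex.I * t)

theorem circ_add (s t : ℝ) : circ (s + t) = circ s * circ t := by
  rw [circ, circ, circ, ← Complex.exp_add]
  push_cast
  ring_nf

theorem norm_circ (t : ℝ) : ‖circ t‖ = 1 := by
  rw [circ, show (2 * Real.pi * Complex.I * t : ℂ) = ((2 * Real.pi * t : ℝ) : ℂ) * Complex.I by
    push_cast; ring]
  exact Complex.norm_exp_ofReal_mul_I _

theorem continuous_circ : Continuous circ := by
  unfold circ
  fun_prop

theorem circ_eq_iff {s t : ℝ} : circ s = circ t ↔ ∃ z : ℤ, s = t + z := by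
  rw [circ, circ, Complex.exp_eq_exp_iff_exists_int]
  refine exists_congr fun z => ?_
  have h : (2 * Real.pi * Complex.I : ℂ) ≠ 0 := Complex.two_pi_I_ne_zero
  rw [show (2 * Real.pi * Complex.I * t + z * (2 * Real.pi * Complex.I) : ℂ)
      = 2 * Real.pi * Complex.I * ((t + z : ℝ) : ℂ) by push_cast; ring]
  rw [mul_right_inj' h]
  exact Complex.ofReal_inj

theorem circ_injOn {s t : ℝ} (hs : 0 ≤ s) (hs1 : s < 1) (ht : 0 ≤ t) (ht1 : t < 1)
    (h : circ s = circ t) : s = t := by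
  obtain ⟨z, hz⟩ := circ_eq_iff.1 h
  have h1 : (z : ℝ) < 1 := by linarith
  have h2 : (-1 : ℝ) < z := by linarith
  have h1' : z < 1 := by exact_mod_cast h1
  have h2' : -1 < z := by exact_mod_cast h2
  obtain rfl : z = 0 := by omega
  simpa using hz

/-- The chord has length 2 sin(π(t - s)). Jordan's inequality sin u ≥ 2u/π on [0, π/2] applies to
π(t - s) or to its supplement. -/
theorem norm_circ_sub_ge {s t p : ℝ} (hp : 0 < p) (h : 1 / p ≤ t - s) (h' : t - s ≤ 1 - 1 / p) :
    4 / p ≤ ‖circ t - circ s‖ := by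
  have e : circ t - circ s = circ s * (circ (t - s) - 1) := by
    rw [mul_sub, ← circ_add, mul_one]
    ring_nf
  have hpp : 0 < 1 / p := by positivity
  rw [e, norm_mul, norm_circ, one_mul, circ,
    show (2 * Real.pi * Complex.I * ((t - s : ℝ) : ℂ))
      = Complex.I * ((2 * Real.pi * (t - s) : ℝ) : ℂ) by push_cast; ring,
    Complex.norm_exp_I_mul_ofReal_sub_one, Real.norm_eq_abs]
  refine le_trans ?_ (le_abs_self _)
  have hpi := Real.pi_pos
  have key : 2 * (1 / p) ≤ Real.sin (Real.pi * (t - s)) := by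
    rcases le_total (t - s) (1 / 2) with h2 | h2
    · have := Real.mul_le_sin (x := Real.pi * (t - s)) (by nlinarith) (by nlinarith)
      have e2 : 2 / Real.pi * (Real.pi * (t - s)) = 2 * (t - s) := by field_simp
      linarith
    · have := Real.mul_le_sin (x := Real.pi * (1 - (t - s))) (by nlinarith) (by nlinarith)
      have e2 : 2 / Real.pi * (Real.pi * (1 - (t - s))) = 2 * (1 - (t - s)) := by field_simp
      rw [show Real.pi * (1 - (t - s)) = Real.pi - Real.pi * (t - s) by ring,
        Real.sin_pi_sub, ← show Real.pi * (1 - (t - s)) = Real.pi - Real.pi * (t - s) by ring] at this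
      linarith
  rw [show 2 * Real.pi * (t - s) / 2 = Real.pi * (t - s) by ring,
    show (4 / p) = 2 * (2 * (1 / p)) by ring]
  linarith

theorem eq_of_norm_circ_sub_lt {u v p : ℕ} (hu : u < p) (hv : v < p)
    (h : ‖circ (u / p) - circ (v / p)‖ < 4 / p) : u = v := by
  have hp : (0 : ℝ) < p := by exact_mod_cast (Nat.zero_le _).trans_lt hu
  have key : ∀ {u v : ℕ}, u < p → v < u → (4 / p : ℝ) ≤ ‖circ (u / p) - circ (v / p)‖ := by
    intro u v hu hv
    have h1 : (v : ℝ) + 1 ≤ u := by exact_mod_cast hv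
    have h2 : (u : ℝ) + 1 ≤ p := by exact_mod_cast hu
    have h3 : (0 : ℝ) ≤ v := by positivity
    refine norm_circ_sub_ge hp ?_ ?_
    · rw [← sub_div]
      gcongr
      linarith
    · rw [← sub_div, le_sub_iff_add_le, ← add_div, div_le_one hp]
      linarith
  rcases lt_trichotomy u v with h1 | h1 | h1
  · rw [norm_sub_rev] at h
    exact absurd (key hv h1) (not_le.2 h)
  · exact h1
  · exact absurd (key hu h1) (not_le.2 h)

/-! ### Runs of equal type -/

section runs

variable {N : ℕ} {A : Matrix (Fin N) (Fin N) ℕ}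

/-- The path obtained by deleting the last `a` edges. -/
def shift (x : LeftPath A) (a : ℕ) : LeftPath A :=
  ⟨fun k => x.1 (a + k), fun k => x.2 (a + k)⟩

theorem shift_shift (x : LeftPath A) (a b : ℕ) : shift (shift x a) b = shift x (a + b) :=
  Subtype.ext (funext fun k => congrArg x.1 (add_assoc a b k).symm)

variable (B : Matrix (Fin N) (Fin N) ℤ)

/-- The entry of `B` belonging to the edge `e`. -/
def typ (e : Edge A) : ℤ := B e.rng e.src

/-- The last `k` edges of `x` have the same type as the very last one. -/
def Run (x : LeftPath A) (k : ℕ) : Prop := ∀ i < k, typ B (x.1 i) = typ B (x.1 0)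

theorem run_one (x : LeftPath A) : Run B x 1 := fun i hi => by
  obtain rfl : i = 0 := by omega
  rfl

variable {B} in
theorem Run.mono {x : LeftPath A} {k l : ℕ} (h : Run B x l) (hkl : k ≤ l) : Run B x k :=
  fun i hi => h i (by omega)

variable {B} in
theorem exists_run_length {x : LeftPath A} (h : ¬ ∀ k, Run B x k) :
    ∃ n, 1 ≤ n ∧ Run B x n ∧ ¬ Run B x (n + 1) := by
  classical
  push Not at h
  have h0 : Nat.find h ≠ 0 := fun e => by
    have := Nat.find_spec h
    rw [e] at this
    exact this fun i hi => absurd hi (by omega)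
  have h1 : Nat.find h ≠ 1 := fun e => by
    have := Nat.find_spec h
    rw [e] at this
    exact this (run_one B x)
  refine ⟨Nat.find h - 1, by omega, not_not.1 (Nat.find_min h (by omega)), ?_⟩
  rw [Nat.sub_add_cancel (by omega)]
  exact Nat.find_spec h

variable {B} in
theorem typ_ne_of_run {x : LeftPath A} {n : ℕ} (h : Run B x n) (h' : ¬ Run B x (n + 1)) :
    typ B (x.1 n) ≠ typ B (x.1 0) := by
  intro e
  refine h' fun i hi => ?_
  rcases Nat.lt_succ_iff_lt_or_eq.1 hi with h1 | rfl
  · exact h i h1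
  · exact e

open Classical in
/-- The digits of `Ω` for the last maximal interval of `x`. -/
def vertexDigit (x : LeftPath A) (k : ℕ) : ℕ := if Run B x k then ((x.1 k).src : ℕ) + 1 else 0

theorem vertexDigit_le (x : LeftPath A) (k : ℕ) : vertexDigit B x k ≤ N := by
  unfold vertexDigit
  split_ifs <;> omega

/-- `Ω` of the last maximal interval of `x`. -/
def runOmega (x : LeftPath A) : ℝ := digitSum (bigR A) (vertexDigit B x)

open Classical in
/-- The digits of `θ` for the last maximal interval of `x`. -/
def labelDigit (x : LeftPath A) (k : ℕ) : ℕ := if Run B x (k + 1) then ((x.1 k).num : ℕ) else 0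

/-- The base `A(e)` or `A(e) + 1` belonging to the type of `e`. -/
def base (e : Edge A) : ℕ := if typ B e = 1 then A e.rng e.src else A e.rng e.src + 1

open Classical in
/-- The bases of `θ` for the last maximal interval of `x`. -/
def labelBase (x : LeftPath A) (k : ℕ) : ℕ := if Run B x (k + 1) then base B (x.1 k) else 1

theorem labelDigit_lt (x : LeftPath A) (k : ℕ) : labelDigit B x k < labelBase B x k := by
  unfold labelDigit labelBase base
  have := (x.1 k).num.isLt
  split_ifs <;> omega

/-- `θ` of the last maximal interval of `x`. -/
def runTheta (x : LeftPath A) : ℝ := radixSum (labelDigit B x) (labelBase B x)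

/-- A maximal interval of `x` ends at the position `a`. -/
def Start (x : LeftPath A) (a : ℕ) : Prop :=
  ∀ k, k + 1 = a → typ B (x.1 k) ≠ typ B (x.1 a)

theorem start_zero (x : LeftPath A) : Start B x 0 := fun k hk => absurd hk (by omega)

/-- The contribution `Ω e^{2πiθ}` of the last maximal interval of `x`. -/
def runTerm (x : LeftPath A) : ℂ := (runOmega B x : ℂ) * circ (runTheta B x)

open Classical in
/-- The contribution to `ζ` of the maximal interval that ends at the position `a`. -/
def term (x : LeftPath A) (a : ℕ) : ℂ :=
  if Start B x a then runTerm B (shift x a) / (bigR A : ℂ) ^ (3 * (a + 1)) else 0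

/-! ### `ζ` as a sum over the positions -/

variable {B}

theorem run_iff_le {x : LeftPath A} {t : ℤ} {I : ℕ × ℕ∞} (hI : IsTypeInterval B x t I) (k : ℕ) :
    Run B (shift x I.1) k ↔ (k : ℕ∞) ≤ I.2 := by
  obtain ⟨a, n⟩ := I
  obtain ⟨h1, h2, -, h4⟩ := hI
  dsimp only at *
  have ht : typ B (x.1 a) = t := h2 a le_rfl <|
    lt_of_lt_of_le (by exact_mod_cast Nat.lt_succ_self a) (add_le_add_right h1 (a : ℕ∞))
  constructor
  · intro h
    by_contra! hk
    lift n to ℕ using ne_top_of_lt hk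
    have hk' : n < k := by exact_mod_cast hk
    exact h4 (a + n) (by push_cast; rfl) ((h n hk').trans ht)
  · intro h i hi
    refine (h2 (a + i) (by omega) ?_).trans ht.symm
    push_cast
    refine (ENat.add_lt_add_iff_left (ENat.natCast_ne_top a)).2 (lt_of_lt_of_le ?_ h)
    exact_mod_cast hi

/-- The closing term r(w_{-n}) is the source of the next edge to the left, that is, of the edge at
position n. It becomes the digit with index n, which is why `vertexDigit` tests `Run B x k` and
`labelDigit` tests `Run B x (k + 1)`. -/
theorem omega_eq {x : LeftPath A} {t : ℤ} {I : ℕ × ℕ∞} (hI : IsTypeInterval B x t I) :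
    Omega (subword x I) I.2 = runOmega B (shift x I.1) := by
  have hr := run_iff_le hI
  have h1 := hI.1
  obtain ⟨a, n⟩ := I
  dsimp only at *
  unfold Omega runOmega digitSum vertexDigit
  induction n using ENat.recTopCoe with
  | top =>
    have h : ∀ k, Run B (shift x a) k := fun k => (hr k).2 le_top
    simp only [h, if_true]
    simp [subword, shift]
  | coe n =>
    have hn : 1 ≤ n := by exact_mod_cast h1
    rw [tsum_eq_sum (s := Finset.range n), tsum_eq_sum (s := Finset.range (n + 1)),
      Finset.sum_range_succ, if_neg (ENat.natCast_ne_top n)]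
    · congr 1
      · refine Finset.sum_congr rfl fun k hk => ?_
        have hk' := Finset.mem_range.1 hk
        rw [if_pos (by exact_mod_cast hk'), if_pos ((hr k).2 (by exact_mod_cast hk'.le))]
        simp [subword, shift]
      · rw [if_pos ((hr n).2 le_rfl)]
        obtain ⟨m, rfl⟩ : ∃ m, n = m + 1 := ⟨n - 1, by omega⟩
        have := x.2 (a + m)
        rw [ENat.toNat_natCast]
        simp [subword, shift, ← add_assoc, this]
    · intro k hk
      have hk' : ¬ k ≤ n := fun h => hk (Finset.mem_range.2 (by omega))
      rw [if_neg fun h => hk' (by exact_mod_cast (hr k).1 h)]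
      simp
    · intro k hk
      exact if_neg fun h => hk (Finset.mem_range.2 (by exact_mod_cast h))

theorem radixProd_labelBase {x : LeftPath A} {k : ℕ} (h : Run B x k) :
    radixProd (labelBase B x) k = ∏ i ∈ Finset.range k, base B (x.1 i) :=
  Finset.prod_congr rfl fun _ hi => if_pos (h.mono (Finset.mem_range.1 hi))

theorem thetaSum_eq {x : LeftPath A} {t : ℤ} {I : ℕ × ℕ∞} (hI : IsTypeInterval B x t I)
    (c : Edge A → ℝ) (hc : ∀ e : Edge A, typ B e = t → c e = base B e) :
    thetaSum c (subword x I) I.2 = runTheta B (shift x I.1) := by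
  have hr := run_iff_le hI
  have ht : typ B (x.1 I.1) = t := hI.2.1 I.1 le_rfl <|
    lt_of_lt_of_le (by exact_mod_cast Nat.lt_succ_self I.1) (add_le_add_right hI.1 (I.1 : ℕ∞))
  unfold thetaSum runTheta radixSum
  refine tsum_congr fun k => ?_
  have hk : (k : ℕ∞) < I.2 ↔ Run B (shift x I.1) (k + 1) := by
    rw [hr]
    rw [Nat.cast_add, Nat.cast_one, ENat.add_one_le_iff (ENat.natCast_ne_top k)]
  unfold labelDigit
  by_cases h : (k : ℕ∞) < I.2
  · have h' := hk.1 h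
    rw [if_pos h, if_pos h', radixProd_labelBase h', Nat.cast_prod]
    congr 1
    refine Finset.prod_congr rfl fun i hi => ?_
    exact hc _ ((h' i (Finset.mem_range.1 hi)).trans ht)
  · rw [if_neg h, if_neg fun h' => h (hk.2 h')]
    simp

open Classical in
/-- The length of the run that starts at the very last edge. -/
def runLength (B : Matrix (Fin N) (Fin N) ℤ) (x : LeftPath A) : ℕ∞ :=
  if h : ∀ k, Run B x k then ⊤ else (exists_run_length h).choose

theorem isTypeInterval_runLength {x : LeftPath A} {a : ℕ} {t : ℤ} (ha : Start B x a)
    (ht : typ B (x.1 a) = t) : IsTypeInterval B x t (a, runLength B (shift x a)) := by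
  unfold runLength
  have e : ∀ i, (shift x a).1 i = x.1 (a + i) := fun i => rfl
  subst ht
  split_ifs with h
  · refine ⟨le_top, fun k hk _ => ?_, fun k hk => ha k hk, fun k hk => ?_⟩
    · obtain ⟨i, rfl⟩ := Nat.exists_eq_add_of_le hk
      exact h (i + 1) i (by omega)
    · simp at hk
  · obtain ⟨h1, h2, h3⟩ := (exists_run_length h).choose_spec
    set n := (exists_run_length h).choose
    refine ⟨Nat.one_le_cast.2 h1, fun k hk hk' => ?_, fun k hk => ha k hk, fun k hk => ?_⟩
    · obtain ⟨i, rfl⟩ := Nat.exists_eq_add_of_le hk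
      dsimp only at hk'
      have : a + i < a + n := by exact_mod_cast hk'
      exact h2 i (by omega)
    · dsimp only at hk
      have : k = a + n := by exact_mod_cast hk
      subst this
      exact typ_ne_of_run h2 h3

theorem start_of_isTypeInterval {x : LeftPath A} {t : ℤ} {I : ℕ × ℕ∞}
    (hI : IsTypeInterval B x t I) : Start B x I.1 ∧ typ B (x.1 I.1) = t := by
  have ht : typ B (x.1 I.1) = t := hI.2.1 I.1 le_rfl <|
    lt_of_lt_of_le (by exact_mod_cast Nat.lt_succ_self I.1) (add_le_add_right hI.1 (I.1 : ℕ∞))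
  exact ⟨fun k hk => by rw [ht]; exact hI.2.2.1 k hk, ht⟩

theorem isTypeInterval_unique {x : LeftPath A} {t : ℤ} {I J : ℕ × ℕ∞}
    (hI : IsTypeInterval B x t I) (hJ : IsTypeInterval B x t J) (h : I.1 = J.1) : I = J := by
  refine Prod.ext h (le_antisymm ?_ ?_)
  · refine ENat.forall_natCast_le_iff_le.1 fun k hk => ?_
    rw [← run_iff_le hJ, ← h, run_iff_le hI]
    exact hk
  · refine ENat.forall_natCast_le_iff_le.1 fun k hk => ?_
    rw [← run_iff_le hI, h, run_iff_le hJ]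
    exact hk

-- An interval is determined by its type and its right end, so the sum can be indexed by right ends;
-- positions where no interval of type `t` ends contribute zero.
open Classical in
theorem tsum_intervals {x : LeftPath A} {t : ℤ} (c : Edge A → ℝ)
    (hc : ∀ e : Edge A, typ B e = t → c e = base B e) :
    ∑' I : {I : ℕ × ℕ∞ // IsTypeInterval B x t I},
      ((Omega (subword x I.1) I.1.2 / bigR A ^ (3 * (I.1.1 + 1)) : ℝ) : ℂ) *
        Complex.exp (2 * Real.pi * Complex.I * (thetaSum c (subword x I.1) I.1.2 : ℝ))
      = ∑' a, if typ B (x.1 a) = t then term B x a else 0 := by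
  have hinj : Function.Injective
      fun I : {I : ℕ × ℕ∞ // IsTypeInterval B x t I} => I.1.1 :=
    fun I J h => Subtype.ext (isTypeInterval_unique I.2 J.2 h)
  rw [← hinj.tsum_eq]
  · refine tsum_congr fun I => ?_
    obtain ⟨hs, ht⟩ := start_of_isTypeInterval I.2
    rw [if_pos ht, term, if_pos hs, omega_eq I.2, thetaSum_eq I.2 c hc, runTerm, circ]
    push_cast
    ring
  · intro a ha
    by_cases ht : typ B (x.1 a) = t
    · by_cases hs : Start B x a
      · exact ⟨⟨_, isTypeInterval_runLength hs ht⟩, rfl⟩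
      · simp [term, hs] at ha
    · simp [ht] at ha

/-! ### Size of the terms and separation of the last interval from the rest -/

section bounds

variable (hA : 2 ≤ maxEntry A)
include hA

theorem bigR_ge : 2 * ((N : ℝ) + 1) ≤ bigR A := by
  unfold bigR
  have : (2 : ℝ) ≤ maxEntry A := by exact_mod_cast hA
  gcongr

theorem bigR_ge_four (x : LeftPath A) : 4 ≤ bigR A := by
  have h := bigR_ge hA
  have : (1 : ℝ) ≤ N := by exact_mod_cast (Nat.zero_le _).trans_lt (x.1 0).rng.isLt
  linarith

theorem norm_runTerm_le (x : LeftPath A) : ‖runTerm B x‖ ≤ 1 / 2 := by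
  have h := bigR_ge hA
  have h1 := bigR_ge_four hA x
  rw [runTerm, norm_mul, norm_circ, mul_one, Complex.norm_real, Real.norm_of_nonneg]
  · exact digitSum_le h (vertexDigit_le B x)
  · exact digitSum_nonneg (by linarith)

theorem norm_term_le (x : LeftPath A) (a : ℕ) :
    ‖term B x a‖ ≤ 1 / 2 / (bigR A ^ 3) ^ (a + 1) := by
  have h1 := bigR_ge_four hA x
  unfold term
  split_ifs
  · rw [norm_div, norm_pow, Complex.norm_real, Real.norm_of_nonneg (by linarith), pow_mul]
    have := norm_runTerm_le (B := B) hA (shift x a)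
    gcongr
  · rw [norm_zero]
    positivity

theorem summable_bound (x : LeftPath A) : Summable fun a : ℕ => 1 / 2 / (bigR A ^ 3) ^ (a + 1) := by
  have h1 := bigR_ge_four hA x
  exact summable_const_div_pow (one_lt_pow₀ (by linarith) (by norm_num)) _

theorem summable_term (x : LeftPath A) : Summable (term B x) :=
  Summable.of_norm_bounded (summable_bound hA x) (norm_term_le hA x)

theorem zeta_eq (hB : ∀ i j, B i j = 0 ∨ B i j = 1) (x : LeftPath A) :
    zeta A B x = ∑' a, term B x a := by
  classical
  have hs : ∀ t : ℤ, Summable fun a => if typ B (x.1 a) = t then term B x a else 0 := by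
    intro t
    refine Summable.of_norm_bounded (summable_bound hA x) fun a => ?_
    split_ifs
    · exact norm_term_le hA x a
    · rw [norm_zero]
      exact (norm_nonneg _).trans (norm_term_le (B := B) hA x a)
  unfold zeta theta0 theta1
  rw [tsum_intervals, tsum_intervals, ← (hs 0).tsum_add (hs 1)]
  · refine tsum_congr fun a => ?_
    rcases hB (x.1 a).rng (x.1 a).src with h | h <;> simp [typ, h]
  · intro e he
    simp [base, he]
  · intro e he
    simp [base, he]

/-- No interval ends at the positions 1, …, m - 1, so what remains after the leading term is a
geometric tail in 1/R³ from position m on. The constant 2/3 absorbs 1/2 · R³/(R³ - 1). -/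
theorem norm_tsum_term_sub_le {x : LeftPath A} {m : ℕ} (hm : 1 ≤ m) (h : Run B x m) :
    ‖∑' a, term B x a - runTerm B x / (bigR A : ℂ) ^ 3‖ ≤ 2 / 3 / (bigR A ^ 3) ^ (m + 1) := by
  have h1 := bigR_ge_four hA x
  have h3 : (64 : ℝ) ≤ bigR A ^ 3 := by
    calc (64 : ℝ) = 4 ^ 3 := by norm_num
      _ ≤ _ := by gcongr
  have hsum : ∑ a ∈ Finset.range m, term B x a = runTerm B x / (bigR A : ℂ) ^ 3 := by
    rw [Finset.sum_eq_single_of_mem 0 (Finset.mem_range.2 (by omega))]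
    · rw [term, if_pos (start_zero B x)]
      congr 2
      exact Subtype.ext (funext fun k => congrArg x.1 (zero_add k))
    · intro a ha ha0
      refine if_neg fun hs => hs (a - 1) (by omega) ?_
      have := Finset.mem_range.1 ha
      rw [h a this, h (a - 1) (by omega)]
  rw [← (summable_term hA x).sum_add_tsum_nat_add m, hsum, add_sub_cancel_left]
  have hs : Summable fun a : ℕ => 1 / 2 / (bigR A ^ 3) ^ m / (bigR A ^ 3) ^ (a + 1) :=
    summable_const_div_pow (by linarith) _
  refine (tsum_of_norm_bounded hs.hasSum fun a => ?_).trans ?_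
  · refine (norm_term_le hA x _).trans (le_of_eq ?_)
    rw [div_div _ _ (_ ^ (a + 1)), ← pow_add]
    congr 2
    ring
  · rw [tsum_const_div_pow (by linarith), pow_succ _ m, div_div, div_div, div_le_div_iff₀]
    · have : (0 : ℝ) < (bigR A ^ 3) ^ m := by positivity
      nlinarith
    · have : (0 : ℝ) < bigR A ^ 3 - 1 := by linarith
      positivity
    · positivity

omit hA in
theorem tsum_term_of_forall_run {x : LeftPath A} (h : ∀ k, Run B x k) :
    ∑' a, term B x a = runTerm B x / (bigR A : ℂ) ^ 3 := by
  rw [tsum_eq_single 0]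
  · rw [term, if_pos (start_zero B x)]
    congr 2
    exact Subtype.ext (funext fun k => congrArg x.1 (zero_add k))
  · intro a ha
    refine if_neg fun hs => hs (a - 1) (by omega) ?_
    rw [h (a + 1) a (by omega), h (a + 1) (a - 1) (by omega)]

theorem tsum_term_of_run {x : LeftPath A} {n : ℕ} (hn : 1 ≤ n) (h : Run B x n)
    (h' : ¬ Run B x (n + 1)) :
    ∑' a, term B x a = runTerm B x / (bigR A : ℂ) ^ 3
      + (∑' a, term B (shift x n) a) / (bigR A : ℂ) ^ (3 * n) := by
  have hsum : ∑ a ∈ Finset.range n, term B x a = runTerm B x / (bigR A : ℂ) ^ 3 := by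
    rw [Finset.sum_eq_single_of_mem 0 (Finset.mem_range.2 (by omega))]
    · rw [term, if_pos (start_zero B x)]
      congr 2
      exact Subtype.ext (funext fun k => congrArg x.1 (zero_add k))
    · intro a ha ha0
      refine if_neg fun hs => hs (a - 1) (by omega) ?_
      have := Finset.mem_range.1 ha
      rw [h a this, h (a - 1) (by omega)]
  rw [← (summable_term hA x).sum_add_tsum_nat_add n, hsum, ← tsum_div_const]
  congr 1
  refine tsum_congr fun a => ?_
  have hst : Start B x (a + n) ↔ Start B (shift x n) a := by
    cases a with
    | zero =>
      refine ⟨fun _ => start_zero B _, fun _ k hk => ?_⟩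
      rw [h k (by omega), zero_add]
      exact (typ_ne_of_run h h').symm
    | succ a =>
      refine ⟨fun hs k hk => ?_, fun hs k hk => ?_⟩
      · have := hs (n + k) (by omega)
        rwa [add_comm (a + 1) n] at this
      · obtain rfl : k = n + a := by omega
        rw [add_comm (a + 1) n]
        exact hs a rfl
  unfold term
  by_cases hs : Start B (shift x n) a
  · rw [if_pos hs, if_pos (hst.2 hs), shift_shift, add_comm n a, div_div, ← pow_add]
    congr 2
    ring
  · rw [if_neg hs, if_neg fun hh => hs (hst.1 hh), zero_div]

end bounds

end runs

section action

variable {N : ℕ} {A : Matrix (Fin N) (Fin N) ℕ} {B : Matrix (Fin N) (Fin N) ℤ}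

/-! ### The action on segments -/

theorem Edge.eq_of_num {e f : Edge A} (hr : e.rng = f.rng) (hs : e.src = f.src)
    (hn : (e.num : ℕ) = f.num) : e = f := by
  obtain ⟨r, s, m⟩ := e
  obtain ⟨r', s', m'⟩ := f
  obtain rfl : r = r' := hr
  obtain rfl : s = s' := hs
  obtain rfl : m = m' := Fin.ext hn
  rfl

theorem seg_injective {x y : ℕ → Edge A} {n : ℕ} (h : seg x n = seg y n) :
    ∀ i ≤ n, x i = y i := by
  induction n with
  | zero =>
    intro i hi
    obtain rfl : i = 0 := by omega
    simpa [seg] using h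
  | succ n ih =>
    simp only [seg, List.cons.injEq] at h
    intro i hi
    rcases Nat.le_succ_iff.1 hi with h1 | rfl
    · exact ih h.2 i h1
    · exact h.1

theorem seg_congr {x y : ℕ → Edge A} {n : ℕ} (h : ∀ i ≤ n, x i = y i) : seg x n = seg y n := by
  induction n with
  | zero => simp [seg, h 0 le_rfl]
  | succ n ih => rw [seg, seg, h _ le_rfl, ih fun i hi => h i (by omega)]

theorem seg_length (x : ℕ → Edge A) (n : ℕ) : (seg x n).length = n + 1 := by
  induction n with
  | zero => rfl
  | succ n ih => rw [seg, List.length_cons, ih]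

theorem seg_append (x : LeftPath A) (a m : ℕ) :
    seg x.1 (a + 1 + m) = seg (shift x (a + 1)).1 m ++ seg x.1 a := by
  induction m with
  | zero => rfl
  | succ m ih => rw [← add_assoc, seg, ih]; rfl

theorem edgeAct_of_typ_zero {e : Edge A} (h : typ B e = 0) (k : ℤ) : edgeAct A B k e = e := by
  simp only [typ] at h
  refine Eq.trans ?_ (edgeAct_zero A B e)
  simp [edgeAct, h]

theorem edgeRes_of_typ_zero {e : Edge A} (h : typ B e = 0) (k : ℤ) : edgeRes A B k e = 0 := by
  simp only [typ] at h
  refine Eq.trans ?_ (edgeRes_zero A B e)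
  simp [edgeRes, h]

theorem ends_of_pathAct {x y : ℕ → Edge A} {n : ℕ} {k : ℤ}
    (h : pathAct A B k (seg x n) = seg y n) :
    ∀ i ≤ n, (x i).rng = (y i).rng ∧ (x i).src = (y i).src := by
  induction n generalizing k with
  | zero =>
    intro i hi
    obtain rfl : i = 0 := by omega
    simp only [seg, pathAct, List.cons.injEq, and_true] at h
    rw [← h]
    exact ⟨rfl, rfl⟩
  | succ n ih =>
    simp only [seg, pathAct, List.cons.injEq] at h
    intro i hi
    rcases Nat.le_succ_iff.1 hi with h1 | rfl
    · exact ih h.2 i h1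
    · rw [← h.1]
      exact ⟨rfl, rfl⟩

/-- An edge of type 0 is fixed and has trivial restriction, so the group element does nothing
further to the right. -/
theorem eq_of_pathAct_of_typ_zero {x y : ℕ → Edge A} {n j : ℕ} {k : ℤ}
    (h : pathAct A B k (seg x n) = seg y n) (hj : j ≤ n) (h0 : typ B (x j) = 0) :
    ∀ i ≤ j, x i = y i := by
  induction n generalizing k with
  | zero =>
    obtain rfl : j = 0 := by omega
    intro i hi
    obtain rfl : i = 0 := by omega
    simpa [seg, pathAct, edgeAct_of_typ_zero h0] using h
  | succ n ih =>
    rcases Nat.le_succ_iff.1 hj with h1 | rfl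
    · simp only [seg, pathAct, List.cons.injEq] at h
      exact ih h.2 h1
    · refine seg_injective ?_
      rwa [seg, pathAct, edgeAct_of_typ_zero h0, edgeRes_of_typ_zero h0, pathAct_zero, ← seg] at h

theorem pathRes_seg_of_typ_zero {x : ℕ → Edge A} {n : ℕ} (h0 : typ B (x 0) = 0) (k : ℤ) :
    pathRes A B k (seg x n) = 0 := by
  induction n generalizing k with
  | zero => simp [seg, pathRes, edgeRes_of_typ_zero h0]
  | succ n ih => rw [seg, pathRes, ih]

theorem pathAct_seg_of_typ_zero {x : ℕ → Edge A} {n : ℕ} (h0 : typ B (x n) = 0) (k : ℤ) :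
    pathAct A B k (seg x n) = seg x n := by
  cases n with
  | zero => simp [seg, pathAct, edgeAct_of_typ_zero h0]
  | succ n => rw [seg, pathAct, edgeAct_of_typ_zero h0, edgeRes_of_typ_zero h0, pathAct_zero]

/-- The sequence of labels of a path. -/
def labels (x : ℕ → Edge A) (i : ℕ) : ℕ := (x i).num

/-- The sequence of the numbers `A(e)` along a path. -/
def sizes (x : ℕ → Edge A) (i : ℕ) : ℕ := A (x i).rng (x i).src

theorem labels_lt (x : ℕ → Edge A) (i : ℕ) : labels x i < sizes x i := (x i).num.isLt

theorem edge_div_mod {e : Edge A} (h : typ B e = 1) (k : ℤ) :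
    k + (e.num : ℕ) = edgeRes A B k e * A e.rng e.src + ((edgeAct A B k e).num : ℕ) := by
  have h0 : (0 : ℤ) < A e.rng e.src := by exact_mod_cast e.num.pos
  simp only [typ] at h
  simp only [edgeRes, edgeAct, h, mul_one]
  rw [Int.toNat_of_nonneg (Int.emod_nonneg _ h0.ne')]
  exact (Int.ediv_mul_add_emod _ _).symm

theorem edgeAct_eq_of_mod {e f : Edge A} (h : typ B e = 1) (hr : e.rng = f.rng)
    (hs : e.src = f.src) {k q : ℤ} (hk : k + (e.num : ℕ) = q * A e.rng e.src + (f.num : ℕ)) :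
    edgeAct A B k e = f ∧ edgeRes A B k e = q := by
  have h0 : (0 : ℤ) < A e.rng e.src := by exact_mod_cast e.num.pos
  have hf : ((f.num : ℕ) : ℤ) < A e.rng e.src := by
    rw [hr, hs]
    exact_mod_cast f.num.isLt
  have hf0 : (0 : ℤ) ≤ (f.num : ℕ) := by positivity
  have h1 := edge_div_mod h k
  have h2 : ((edgeAct A B k e).num : ℕ) < A e.rng e.src := (edgeAct A B k e).num.isLt
  have h3 : (((edgeAct A B k e).num : ℕ) : ℤ) < A e.rng e.src := by exact_mod_cast h2
  have h4 : (0 : ℤ) ≤ ((edgeAct A B k e).num : ℕ) := by positivity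
  rw [hk] at h1
  have hq : edgeRes A B k e = q := by
    have a1 : (q - edgeRes A B k e) * A e.rng e.src < 1 * A e.rng e.src := by linarith
    have a2 : (-1) * (A e.rng e.src : ℤ) < (q - edgeRes A B k e) * A e.rng e.src := by linarith
    have := lt_of_mul_lt_mul_right a1 h0.le
    have := lt_of_mul_lt_mul_right a2 h0.le
    omega
  refine ⟨Edge.eq_of_num hr hs ?_, hq⟩
  rw [hq] at h1
  have : (((edgeAct A B k e).num : ℕ) : ℤ) = (f.num : ℕ) := by linarith
  exact_mod_cast this

/-- The action on type 1 edges is addition with carry: the leftmost edge holds the least significant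
digit, and carries move to the right. Here `q` is the carry out of the most significant digit. -/
theorem radixVal_of_pathAct {x y : ℕ → Edge A} {n : ℕ} {k : ℤ} (h1 : ∀ i ≤ n, typ B (x i) = 1)
    (h : pathAct A B k (seg x n) = seg y n) :
    ∃ q : ℤ, (radixVal (labels x) (sizes x) (n + 1) : ℤ) + k
      = radixVal (labels y) (sizes x) (n + 1) + radixProd (sizes x) (n + 1) * q := by
  induction n generalizing k with
  | zero =>
    simp only [seg, pathAct, List.cons.injEq, and_true] at h
    refine ⟨edgeRes A B k (x 0), ?_⟩
    have := edge_div_mod (h1 0 le_rfl) k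
    rw [h] at this
    simp only [radixVal, radixProd_succ, radixProd_zero, labels, sizes]
    push_cast
    linarith
  | succ n ih =>
    simp only [seg, pathAct, List.cons.injEq] at h
    obtain ⟨q, hq⟩ := ih (fun i hi => h1 i (by omega)) h.2
    refine ⟨q, ?_⟩
    have := edge_div_mod (h1 (n + 1) le_rfl) k
    rw [h.1] at this
    rw [radixVal, radixVal.eq_2 (labels y), radixProd_succ]
    have e : ((sizes x (n + 1) : ℕ) : ℤ) = A (x (n + 1)).rng (x (n + 1)).src := rfl
    push_cast
    simp only [labels, e]
    linear_combination (A (x (n + 1)).rng (x (n + 1)).src : ℤ) * hq + this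

theorem pathAct_of_radixVal {x y : ℕ → Edge A} {n : ℕ} {k q : ℤ} (h1 : ∀ i ≤ n, typ B (x i) = 1)
    (he : ∀ i ≤ n, (x i).rng = (y i).rng ∧ (x i).src = (y i).src)
    (h : (radixVal (labels x) (sizes x) (n + 1) : ℤ) + k
      = radixVal (labels y) (sizes x) (n + 1) + radixProd (sizes x) (n + 1) * q) :
    pathAct A B k (seg x n) = seg y n := by
  induction n generalizing k with
  | zero =>
    simp only [radixVal, radixProd_succ, radixProd_zero, labels, sizes] at h
    rw [seg, seg, pathAct, pathAct,
      (edgeAct_eq_of_mod (h1 0 le_rfl) (he 0 le_rfl).1 (he 0 le_rfl).2 (k := k) (q := q) ?_).1]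
    push_cast at h
    linarith
  | succ n ih =>
    rw [radixVal, radixVal.eq_2 (labels y), radixProd_succ] at h
    have e : ((sizes x (n + 1) : ℕ) : ℤ) = A (x (n + 1)).rng (x (n + 1)).src := rfl
    push_cast at h
    simp only [labels, e] at h
    obtain ⟨h2, h3⟩ := edgeAct_eq_of_mod (h1 (n + 1) le_rfl) (he (n + 1) le_rfl).1
      (he (n + 1) le_rfl).2 (k := k) (q := (radixVal (labels y) (sizes x) (n + 1) : ℤ)
        + radixProd (sizes x) (n + 1) * q - radixVal (labels x) (sizes x) (n + 1))
      (by linear_combination h)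
    rw [seg, seg, pathAct, h2, h3, ih (fun i hi => h1 i (by omega)) fun i hi => he i (by omega)]
    ring

/-! ### Asymptotic equivalence in terms of integers -/

/-- Finitely many group elements have integer representatives with a common bound; conversely, there
are only finitely many vertices and finitely many integers in [-C, C]. -/
theorem asympEquiv_iff {x y : LeftPath A} : AsympEquiv A B x y ↔
    ∃ C : ℕ, ∀ n, ∃ k : ℤ, k.natAbs ≤ C ∧ pathAct A B k (seg x.1 n) = seg y.1 n := by
  constructor
  · rintro ⟨F, hF, g, hg, hm⟩
    have hl : ∀ t : Total A B, ∃ k : Multiplicative ℤ, (QuotientGroup.mk k : GB A B t.1) = t.2 :=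
      fun t => QuotientGroup.mk_surjective t.2
    choose l hl using hl
    obtain ⟨C, hC⟩ := (hF.image fun t => (l t).toAdd.natAbs).bddAbove
    refine ⟨C, fun n => ⟨(l (g n)).toAdd, hC ⟨_, hg n, rfl⟩, ?_⟩⟩
    obtain ⟨h, he⟩ := hm n
    rw [← hl (g n)] at he
    exact he
  · rintro ⟨C, h⟩
    choose k hk he using h
    refine ⟨Set.image2 (fun (v : Fin N) (j : ℤ) =>
        (⟨v, QuotientGroup.mk (Multiplicative.ofAdd j)⟩ : Total A B)) Set.univ (Set.Icc (-C) C),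
      Set.finite_univ.image2 _ (Set.finite_Icc _ _), fun n => ⟨(x.1 n).rng,
        QuotientGroup.mk (Multiplicative.ofAdd (k n))⟩,
      fun n => ⟨_, Set.mem_univ _, k n, ?_, rfl⟩, fun n => ⟨isPathFrom_seg x n, he n⟩⟩
    have := hk n
    constructor <;> omega

theorem AsympEquiv.shift {x y : LeftPath A} (h : AsympEquiv A B x y) (a : ℕ) :
    AsympEquiv A B (shift x a) (shift y a) := by
  cases a with
  | zero =>
    have e : ∀ z : LeftPath A, KEP.shift z 0 = z := fun z =>
      Subtype.ext (funext fun k => congrArg z.1 (zero_add k))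
    rwa [e, e]
  | succ a =>
    rw [asympEquiv_iff] at h ⊢
    obtain ⟨C, h⟩ := h
    refine ⟨C, fun n => ?_⟩
    obtain ⟨k, hk, he⟩ := h (a + 1 + n)
    refine ⟨k, hk, ?_⟩
    rw [seg_append, seg_append, pathAct_append] at he
    exact (List.append_inj he (by rw [pathAct_length, seg_length, seg_length])).1

theorem AsympEquiv.ends {x y : LeftPath A} (h : AsympEquiv A B x y) (i : ℕ) :
    (x.1 i).rng = (y.1 i).rng ∧ (x.1 i).src = (y.1 i).src := by
  obtain ⟨C, h⟩ := asympEquiv_iff.1 h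
  obtain ⟨k, -, he⟩ := h i
  exact ends_of_pathAct he i le_rfl

theorem AsympEquiv.eq_of_typ_zero {x y : LeftPath A} (h : AsympEquiv A B x y) {j : ℕ}
    (h0 : typ B (x.1 j) = 0) : ∀ i ≤ j, x.1 i = y.1 i := by
  obtain ⟨C, h⟩ := asympEquiv_iff.1 h
  obtain ⟨k, -, he⟩ := h j
  exact eq_of_pathAct_of_typ_zero he le_rfl h0

end action

section injectivity

variable {N : ℕ} {A : Matrix (Fin N) (Fin N) ℕ} {B : Matrix (Fin N) (Fin N) ℤ}

/-! ### `ζ` determines the path up to asymptotic equivalence -/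

theorem vertexDigit_ne_zero_iff {x : LeftPath A} {k : ℕ} : vertexDigit B x k ≠ 0 ↔ Run B x k := by
  unfold vertexDigit
  split_ifs with h <;> simp [h]

theorem norm_runTerm (hA : 2 ≤ maxEntry A) (x : LeftPath A) : ‖runTerm B x‖ = runOmega B x := by
  have h1 := bigR_ge_four hA x
  rw [runTerm, norm_mul, norm_circ, mul_one, Complex.norm_real, Real.norm_of_nonneg]
  exact digitSum_nonneg (by linarith)

theorem norm_runTerm_sub_le (hA : 2 ≤ maxEntry A) {x y : LeftPath A}
    (h : ∑' a, term B x a = ∑' a, term B y a) {m n : ℕ} (hm : 1 ≤ m) (hn : 1 ≤ n) (hx : Run B x m)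
    (hy : Run B y n) :
    ‖runTerm B y - runTerm B x‖ ≤ 2 / 3 / (bigR A ^ 3) ^ m + 2 / 3 / (bigR A ^ 3) ^ n := by
  have h1 := bigR_ge_four hA x
  have hR : 0 < bigR A ^ 3 := by positivity
  have hx' := norm_tsum_term_sub_le hA hm hx
  have hy' := norm_tsum_term_sub_le hA hn hy
  have hR' : ‖(bigR A : ℂ) ^ 3‖ = bigR A ^ 3 := by
    rw [norm_pow, Complex.norm_real, Real.norm_of_nonneg (by linarith)]
  have h0 : (bigR A : ℂ) ^ 3 ≠ 0 := by
    rw [← norm_ne_zero_iff, hR']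
    exact hR.ne'
  rw [← h] at hy'
  set Z := ∑' a, term B x a
  have e : runTerm B y - runTerm B x = (bigR A : ℂ) ^ 3 *
      ((Z - runTerm B x / (bigR A : ℂ) ^ 3) - (Z - runTerm B y / (bigR A : ℂ) ^ 3)) := by
    rw [sub_sub_sub_cancel_left, mul_sub, mul_div_cancel₀ _ h0, mul_div_cancel₀ _ h0]
  have h3 := (norm_sub_le (Z - runTerm B x / (bigR A : ℂ) ^ 3)
    (Z - runTerm B y / (bigR A : ℂ) ^ 3)).trans (add_le_add hx' hy')
  rw [e, norm_mul, hR']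
  refine (mul_le_mul_of_nonneg_left h3 hR.le).trans (le_of_eq ?_)
  rw [pow_succ _ m, pow_succ _ n]
  field_simp

theorem runOmega_sub_le (hA : 2 ≤ maxEntry A) {x y : LeftPath A}
    (h : ∑' a, term B x a = ∑' a, term B y a) {m n : ℕ} (hm : 1 ≤ m) (hn : 1 ≤ n) (hx : Run B x m)
    (hy : Run B y n) :
    runOmega B y - runOmega B x ≤ 2 / 3 / (bigR A ^ 3) ^ m + 2 / 3 / (bigR A ^ 3) ^ n := by
  rw [← norm_runTerm hA, ← norm_runTerm hA]
  exact (norm_sub_norm_le _ _).trans (norm_runTerm_sub_le hA h hm hn hx hy)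

/-- At a first difference the values of Ω are further apart than the error of `runOmega_sub_le`
allows. The delicate case is that of the interval of `x` being already over. -/
theorem not_vertexDigit_lt (hA : 2 ≤ maxEntry A) {x y : LeftPath A}
    (h : ∑' a, term B x a = ∑' a, term B y a) {k : ℕ}
    (heq : ∀ i < k, vertexDigit B x i = vertexDigit B y i) :
    ¬ vertexDigit B x k < vertexDigit B y k := by
  intro hlt
  have hR := bigR_ge hA
  have h4 := bigR_ge_four hA x
  have hy : Run B y k := vertexDigit_ne_zero_iff.1 (by omega)
  by_cases h0 : vertexDigit B x k = 0
  · have hx : ¬ Run B x k := fun h' => vertexDigit_ne_zero_iff.2 h' h0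
    obtain ⟨m, rfl⟩ : ∃ m, k = m + 1 :=
      Nat.exists_eq_succ_of_ne_zero fun e => hx (by rw [e]; intro i hi; omega)
    have hm : 1 ≤ m := by
      by_contra! hm
      obtain rfl : m = 0 := by omega
      exact hx (run_one B x)
    have hxm : Run B x m := by
      rw [← vertexDigit_ne_zero_iff, heq m (by omega), vertexDigit_ne_zero_iff]
      exact hy.mono (by omega)
    have h1 := runOmega_sub_le hA h hm (by omega) hxm hy
    have h2 := digitSum_lower_one hR (vertexDigit_le B x) (vertexDigit_le B y) heq hlt fun i hi => by
      by_contra h'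
      exact hx ((vertexDigit_ne_zero_iff.1 h').mono hi.le)
    -- For m = 1 the two sides are equal, so the error 2/3 + 1/6 has to be compared with a full
    -- unit; the gap 1/2 would not suffice.
    have h3 : 1 / (bigR A ^ 3) ^ m ≤ 1 / bigR A ^ (m + 1 + 1) := by
      rw [← pow_mul]
      exact one_div_le_one_div_of_le (by positivity)
        (pow_le_pow_right₀ (by linarith) (by omega))
    have h5 : 2 / 3 / (bigR A ^ 3) ^ (m + 1) ≤ 1 / 6 * (1 / (bigR A ^ 3) ^ m) := by
      rw [pow_succ, div_le_iff₀ (by positivity)]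
      have : (4 : ℝ) ≤ bigR A ^ 3 := h4.trans (le_self_pow₀ (by linarith) (by norm_num))
      field_simp
      linarith
    have h6 : 0 < 1 / (bigR A ^ 3) ^ m := by positivity
    have h7 : 2 / 3 / (bigR A ^ 3) ^ m = 2 / 3 * (1 / (bigR A ^ 3) ^ m) := by ring
    unfold runOmega at h1
    linarith
  · have hx : Run B x k := vertexDigit_ne_zero_iff.1 h0
    -- The error bound requires a run of length at least 1, which is automatic; this covers k = 0.
    have hmax : ∀ z : LeftPath A, Run B z k → Run B z (max k 1) := fun z hz => by
      rcases max_choice k 1 with e | e <;> rw [e]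
      · exact hz
      · exact run_one B z
    have h1 := runOmega_sub_le hA h (le_max_right k 1) (le_max_right k 1) (hmax x hx) (hmax y hy)
    have h2 := digitSum_lower_half hR (vertexDigit_le B x) (vertexDigit_le B y) heq hlt
    have h3 : 1 / (bigR A ^ 3) ^ (max k 1) ≤ 1 / bigR A ^ (k + 1 + 1) := by
      rw [← pow_mul]
      exact one_div_le_one_div_of_le (by positivity)
        (pow_le_pow_right₀ (by linarith) (by omega))
    have h5 : 1 / bigR A ^ (k + 1 + 1) ≤ 1 / 4 * (1 / bigR A ^ (k + 1)) := by
      rw [pow_succ _ (k + 1), div_le_iff₀ (by positivity)]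
      field_simp
      linarith
    have h6 : 0 < 1 / bigR A ^ (k + 1) := by positivity
    have h7 : 2 / 3 / (bigR A ^ 3) ^ (max k 1) = 2 / 3 * (1 / (bigR A ^ 3) ^ (max k 1)) := by ring
    have h8 : 1 / 2 / bigR A ^ (k + 1) = 1 / 2 * (1 / bigR A ^ (k + 1)) := by ring
    unfold runOmega at h1
    linarith

theorem vertexDigit_eq (hA : 2 ≤ maxEntry A) {x y : LeftPath A}
    (h : ∑' a, term B x a = ∑' a, term B y a) : vertexDigit B x = vertexDigit B y := by
  funext k
  induction k using Nat.strong_induction_on with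
  | _ k ih =>
    exact le_antisymm (not_lt.1 (not_vertexDigit_lt hA h.symm fun i hi => (ih i hi).symm))
      (not_lt.1 (not_vertexDigit_lt hA h ih))

theorem run_iff_of_vertexDigit_eq {x y : LeftPath A} (h : vertexDigit B x = vertexDigit B y)
    (k : ℕ) : Run B x k ↔ Run B y k := by
  rw [← vertexDigit_ne_zero_iff, h, vertexDigit_ne_zero_iff]

theorem ends_of_vertexDigit_eq {x y : LeftPath A} (h : vertexDigit B x = vertexDigit B y) {k : ℕ}
    (hk : Run B x (k + 1)) : (x.1 k).rng = (y.1 k).rng ∧ (x.1 k).src = (y.1 k).src := by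
  have key : ∀ {k}, Run B x k → (x.1 k).src = (y.1 k).src := by
    intro k hk
    have := congrFun h k
    rw [vertexDigit, vertexDigit, if_pos hk, if_pos ((run_iff_of_vertexDigit_eq h k).1 hk)] at this
    exact Fin.ext (by omega)
  refine ⟨?_, key (hk.mono (by omega))⟩
  rw [← x.2 k, ← y.2 k]
  exact key hk

/-! ### Recovering the labels of the last interval -/

theorem labelBase_eq_of_ends {x y : LeftPath A} (hr : ∀ k, Run B x k ↔ Run B y k)
    (he : ∀ k, Run B x (k + 1) → (x.1 k).rng = (y.1 k).rng ∧ (x.1 k).src = (y.1 k).src) :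
    labelBase B x = labelBase B y := by
  funext k
  unfold labelBase
  by_cases hk : Run B x (k + 1)
  · rw [if_pos hk, if_pos ((hr _).1 hk), base, base, typ, typ, (he k hk).1, (he k hk).2]
  · rw [if_neg hk, if_neg fun h' => hk ((hr _).2 h')]

theorem edge_eq_of_labelDigit {x y : LeftPath A} (h : vertexDigit B x = vertexDigit B y)
    (hl : labelDigit B x = labelDigit B y) {k : ℕ} (hk : Run B x (k + 1)) : x.1 k = y.1 k := by
  obtain ⟨h1, h2⟩ := ends_of_vertexDigit_eq h hk
  refine Edge.eq_of_num h1 h2 ?_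
  have := congrFun hl k
  rwa [labelDigit, labelDigit, if_pos hk, if_pos ((run_iff_of_vertexDigit_eq h _).1 hk)] at this

theorem one_div_le_runOmega (hA : 2 ≤ maxEntry A) (x : LeftPath A) :
    1 / bigR A ≤ runOmega B x := by
  have h4 := bigR_ge_four hA x
  rw [runOmega, digitSum_split (by linarith) (vertexDigit_le B x) 1, Finset.sum_range_one, zero_add,
    pow_one]
  have h1 : (1 : ℝ) ≤ vertexDigit B x 0 := by
    exact_mod_cast Nat.one_le_iff_ne_zero.2
      (vertexDigit_ne_zero_iff.2 ((run_one B x).mono (by omega)))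
  have h2 := digitSum_nonneg (R := bigR A) (d := fun k => vertexDigit B x (k + 1)) (by linarith)
  have h3 : 1 / bigR A ≤ vertexDigit B x 0 / bigR A := by gcongr
  have h5 : 0 ≤ digitSum (bigR A) (fun k => vertexDigit B x (k + 1)) / bigR A :=
    div_nonneg h2 (by linarith)
  linarith

/-- The bound M + 1 ≤ M(N + 1) makes the product of n bases at most R^n, which the separation of
phases in `labelDigit_eq_of_finite` requires. -/
theorem base_le_bigR (hA : 2 ≤ maxEntry A) (e : Edge A) : (base B e : ℝ) ≤ bigR A := by
  have h1 : A e.rng e.src ≤ maxEntry A :=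
    Finset.le_sup (f := fun ij : Fin N × Fin N => A ij.1 ij.2) (Finset.mem_univ (e.rng, e.src))
  have h2 : base B e ≤ maxEntry A + 1 := by
    unfold base
    split_ifs <;> omega
  have h3 : (1 : ℝ) ≤ N := by exact_mod_cast (Nat.zero_le _).trans_lt e.rng.isLt
  have h4 : (base B e : ℝ) ≤ maxEntry A + 1 := by exact_mod_cast h2
  have h5 : (2 : ℝ) ≤ maxEntry A := by exact_mod_cast hA
  unfold bigR
  nlinarith

theorem radixProd_le (hA : 2 ≤ maxEntry A) (x : LeftPath A) (n : ℕ) :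
    (radixProd (labelBase B x) n : ℝ) ≤ bigR A ^ n := by
  have h4 := bigR_ge_four hA x
  induction n with
  | zero => simp [radixProd_zero]
  | succ n ih =>
    rw [radixProd_succ, pow_succ]
    push_cast
    refine mul_le_mul ih ?_ (by positivity) (by positivity)
    unfold labelBase
    split_ifs
    · exact base_le_bigR hA _
    · push_cast
      linarith

theorem labelDigit_eq_zero {x : LeftPath A} {n : ℕ} (h : ¬ Run B x (n + 1)) (k : ℕ) (hk : n ≤ k) :
    labelDigit B x k = 0 :=
  if_neg fun h' => h (h'.mono (by omega))

/-- Both phases are P-th roots of unity with P ≤ R^n, hence equal or at least 4/R^n apart. Dividing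
the error by Ω ≥ 1/R leaves at most (4/3) R^{1-3n} ≤ (4/3)/R^n. Finite expansions have all tails
below 1, so equal values have equal digits. -/
theorem labelDigit_eq_of_finite (hA : 2 ≤ maxEntry A) {x y : LeftPath A}
    (h : ∑' a, term B x a = ∑' a, term B y a) {n : ℕ} (hn : 1 ≤ n) (hx : Run B x n)
    (hx' : ¬ Run B x (n + 1)) : labelDigit B x = labelDigit B y := by
  have hv := vertexDigit_eq hA h
  have hr := run_iff_of_vertexDigit_eq hv
  have hb : labelBase B x = labelBase B y :=
    labelBase_eq_of_ends hr fun k hk => ends_of_vertexDigit_eq hv hk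
  have hlx := labelDigit_lt B x
  have hly := labelDigit_lt B y
  rw [← hb] at hly
  have h4 := bigR_ge_four hA x
  have hzx := labelDigit_eq_zero hx'
  have hzy := labelDigit_eq_zero (x := y) fun h' => hx' ((hr _).2 h')
  have ex := radixSum_of_finite hlx hzx
  have ey := radixSum_of_finite hly hzy
  have h1 := norm_runTerm_sub_le hA h hn hn hx ((hr n).1 hx)
  have hO : runOmega B y = runOmega B x := by rw [runOmega, runOmega, hv]
  have hp : (0 : ℝ) < radixProd (labelBase B x) n := by exact_mod_cast radixProd_pos hlx n
  rw [runTerm, runTerm, hO, ← mul_sub, norm_mul, Complex.norm_real, runTheta, runTheta, ← hb, ex, ey]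
    at h1
  have h2 := one_div_le_runOmega (B := B) hA x
  have h3 : 1 / bigR A * ‖circ (radixVal (labelDigit B y) (labelBase B x) n
      / radixProd (labelBase B x) n) - circ (radixVal (labelDigit B x) (labelBase B x) n
      / radixProd (labelBase B x) n)‖ ≤ 2 / 3 / (bigR A ^ 3) ^ n + 2 / 3 / (bigR A ^ 3) ^ n :=
    (mul_le_mul_of_nonneg_right (h2.trans (Real.le_norm_self _)) (norm_nonneg _)).trans h1
  have h5 : 1 / (bigR A ^ 3) ^ n ≤ 1 / bigR A ^ (n + 1) := by
    rw [← pow_mul]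
    exact one_div_le_one_div_of_le (by positivity) (pow_le_pow_right₀ (by linarith) (by omega))
  have h6 : 1 / bigR A ^ n ≤ 1 / radixProd (labelBase B x) n :=
    one_div_le_one_div_of_le hp (radixProd_le hA x n)
  have hV := eq_of_norm_circ_sub_lt (radixVal_lt hly n) (radixVal_lt hlx n) (by
    rw [one_div_mul_eq_div, div_le_iff₀ (by linarith)] at h3
    refine h3.trans_lt ?_
    have e1 : 1 / bigR A ^ (n + 1) * bigR A = 1 / bigR A ^ n := by
      rw [pow_succ]
      field_simp
    have h7 := mul_le_mul_of_nonneg_right h5 (by linarith : (0 : ℝ) ≤ bigR A)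
    have h8 : 0 < 1 / bigR A ^ n := by positivity
    have e2 : (2 / 3 / (bigR A ^ 3) ^ n + 2 / 3 / (bigR A ^ 3) ^ n) * bigR A
        = 4 / 3 * (1 / (bigR A ^ 3) ^ n * bigR A) := by ring
    have e3 : 4 / (radixProd (labelBase B x) n : ℝ) = 4 * (1 / radixProd (labelBase B x) n) := by
      ring
    rw [e2, e3]
    linarith)
  refine radixSum_injective hlx hly (fun m => ?_) (fun m => ?_) (by rw [ex, ey, hV])
  · exact radixSum_lt_one_of_finite (n := n) (fun k => hlx _) fun k hk => hzx _ (by omega)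
  · exact radixSum_lt_one_of_finite (n := n) (fun k => hly _) fun k hk => hzy _ (by omega)

theorem circ_runTheta_eq (hA : 2 ≤ maxEntry A) {x y : LeftPath A}
    (h : ∑' a, term B x a = ∑' a, term B y a) (hx : ∀ k, Run B x k) :
    circ (runTheta B x) = circ (runTheta B y) := by
  have hv := vertexDigit_eq hA h
  have hr := run_iff_of_vertexDigit_eq hv
  have h4 := bigR_ge_four hA x
  rw [tsum_term_of_forall_run hx, tsum_term_of_forall_run fun k => (hr k).1 (hx k)] at h
  have h0 : (bigR A : ℂ) ^ 3 ≠ 0 :=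
    pow_ne_zero _ (Complex.ofReal_ne_zero.2 (by linarith))
  have h1 : runTerm B x = runTerm B y := (div_left_inj' h0).1 h
  have hO : runOmega B y = runOmega B x := by rw [runOmega, runOmega, hv]
  rw [runTerm, runTerm, hO] at h1
  have h2 := one_div_le_runOmega (B := B) hA x
  have h3 : 0 < 1 / bigR A := by positivity
  exact mul_left_cancel₀ (Complex.ofReal_ne_zero.2 (by linarith)) h1

theorem labelDigit_eq_of_typ_zero (hA : 2 ≤ maxEntry A) {x y : LeftPath A}
    (h : ∑' a, term B x a = ∑' a, term B y a) (hx : ∀ k, Run B x k) (h0 : typ B (x.1 0) = 0) :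
    labelDigit B x = labelDigit B y := by
  have hv := vertexDigit_eq hA h
  have hr := run_iff_of_vertexDigit_eq hv
  have he := fun k (hk : Run B x (k + 1)) => ends_of_vertexDigit_eq hv hk
  have hb : labelBase B x = labelBase B y := labelBase_eq_of_ends hr he
  have hg : ∀ z : LeftPath A, (∀ k, Run B z k) → typ B (z.1 0) = 0 →
      ∀ k, labelDigit B z k + 1 < labelBase B z k := by
    intro z hz hz0 k
    have h1 : typ B (z.1 k) = 0 := by rw [hz (k + 1) k (by omega), hz0]
    have := (z.1 k).num.isLt
    rw [labelDigit, labelBase, if_pos (hz _), if_pos (hz _), base, if_neg (by rw [h1]; decide)]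
    omega
  have hgx := hg x hx h0
  have hgy := hg y (fun k => (hr k).1 (hx k)) (by
    rw [← h0, typ, typ, (he 0 (hx _)).1, (he 0 (hx _)).2])
  rw [← hb] at hgy
  have hc := circ_runTheta_eq hA h hx
  unfold runTheta at hc
  rw [← hb] at hc
  refine radixSum_injective (fun k => (Nat.lt_succ_self _).trans (hgx k))
    (fun k => (Nat.lt_succ_self _).trans (hgy k))
    (fun m => radixSum_lt_one_of_gap fun k => hgx _) (fun m => radixSum_lt_one_of_gap fun k => hgy _)
    (circ_injOn radixSum_nonneg (radixSum_lt_one_of_gap hgx) radixSum_nonneg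
      (radixSum_lt_one_of_gap hgy) hc)

theorem labelDigit_eq_labels {x : LeftPath A} (hx : ∀ k, Run B x k) :
    labelDigit B x = labels x.1 :=
  funext fun _ => if_pos (hx _)

theorem labelBase_eq_sizes {x : LeftPath A} (hx : ∀ k, Run B x k) (h1 : typ B (x.1 0) = 1) :
    labelBase B x = sizes x.1 :=
  funext fun k => (if_pos (hx _)).trans (if_pos ((hx (k + 1) k (by omega)).trans h1))

/-- If the values of θ differ by the integer `z`, the truncations U and V + (-z)P are integer parts,
up to one unit, of the same real number. Their difference is the integer that acts. -/
theorem exists_pathAct_of_typ_one (hA : 2 ≤ maxEntry A) {x y : LeftPath A}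
    (h : ∑' a, term B x a = ∑' a, term B y a) (hx : ∀ k, Run B x k) (h1 : typ B (x.1 0) = 1)
    (m : ℕ) : ∃ k : ℤ, k.natAbs ≤ 1 ∧ pathAct A B k (seg x.1 m) = seg y.1 m := by
  have hv := vertexDigit_eq hA h
  have hr := run_iff_of_vertexDigit_eq hv
  have he := fun k => ends_of_vertexDigit_eq hv (hx (k + 1))
  have hb : labelBase B x = labelBase B y := labelBase_eq_of_ends hr fun k _ => he k
  obtain ⟨z, hz⟩ := circ_eq_iff.1 (circ_runTheta_eq hA h hx).symm
  have bx := radixSum_bounds (labelDigit_lt B x) (m + 1)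
  have bY := radixSum_bounds (labelDigit_lt B y) (m + 1)
  rw [← hb] at bY
  unfold runTheta at hz
  rw [← hb] at hz
  rw [hz, add_mul] at bY
  set P := radixProd (labelBase B x) (m + 1) with hP
  set U := radixVal (labelDigit B x) (labelBase B x) (m + 1) with hU
  set V := radixVal (labelDigit B y) (labelBase B x) (m + 1) with hV
  obtain ⟨k, hk⟩ : ∃ k : ℤ, k = V - U - z * P := ⟨_, rfl⟩
  have hk' : (k : ℝ) = V - U - z * P := by rw [hk]; push_cast; ring
  have k1 : (k : ℝ) ≤ 1 := by linarith
  have k2 : (-1 : ℝ) ≤ k := by linarith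
  have k1' : k ≤ 1 := by exact_mod_cast k1
  have k2' : -1 ≤ k := by exact_mod_cast k2
  refine ⟨k, by omega, pathAct_of_radixVal (q := -z) (fun i _ => ?_) (fun i _ => he i) ?_⟩
  · rw [hx (i + 1) i (by omega), h1]
  · rw [← labelBase_eq_sizes hx h1, ← labelDigit_eq_labels hx,
      ← labelDigit_eq_labels fun k => (hr k).1 (hx k), ← hP, ← hU, ← hV, hk]
    ring

/-- Strong induction on the length of the segment: a finite last interval agrees in both paths and
is removed. The bound 1 does not grow, since the integer found further left acts trivially on the
removed interval. -/
theorem exists_pathAct_of_tsum_term_eq (hA : 2 ≤ maxEntry A)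
    (hB : ∀ i j, B i j = 0 ∨ B i j = 1) (m : ℕ) : ∀ {x y : LeftPath A},
      ∑' a, term B x a = ∑' a, term B y a →
      ∃ k : ℤ, k.natAbs ≤ 1 ∧ pathAct A B k (seg x.1 m) = seg y.1 m := by
  induction m using Nat.strong_induction_on with
  | _ m ih =>
    intro x y h
    have hv := vertexDigit_eq hA h
    have hr := run_iff_of_vertexDigit_eq hv
    by_cases hx : ∀ k, Run B x k
    · rcases hB (x.1 0).rng (x.1 0).src with h0 | h1
      · refine ⟨0, by simp, ?_⟩
        rw [pathAct_zero]
        exact seg_congr fun i _ =>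
          edge_eq_of_labelDigit hv (labelDigit_eq_of_typ_zero hA h hx h0) (hx _)
      · exact exists_pathAct_of_typ_one hA h hx h1 m
    · obtain ⟨n, hn, hxn, hxn'⟩ := exists_run_length hx
      have hl := labelDigit_eq_of_finite hA h hn hxn hxn'
      have heq : ∀ i < n, x.1 i = y.1 i := fun i hi =>
        edge_eq_of_labelDigit hv hl (hxn.mono hi)
      rcases lt_or_ge m n with hmn | hmn
      · refine ⟨0, by simp, ?_⟩
        rw [pathAct_zero]
        exact seg_congr fun i hi => heq i (by omega)
      · obtain ⟨a, rfl⟩ : ∃ a, n = a + 1 := ⟨n - 1, by omega⟩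
        obtain ⟨l, rfl⟩ := Nat.exists_eq_add_of_le hmn
        have hb := labelBase_eq_of_ends hr fun k hk => ends_of_vertexDigit_eq hv hk
        have ht : runTerm B x = runTerm B y := by
          rw [runTerm, runTerm, runOmega, runOmega, runTheta, runTheta, hv, hl, hb]
        rw [tsum_term_of_run hA hn hxn hxn',
          tsum_term_of_run hA hn ((hr _).1 hxn) fun h' => hxn' ((hr _).2 h'), ht] at h
        have h4 := bigR_ge_four hA x
        have h0 : (bigR A : ℂ) ^ (3 * (a + 1)) ≠ 0 :=
          pow_ne_zero _ (Complex.ofReal_ne_zero.2 (by linarith))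
        obtain ⟨k, hk, hk'⟩ := ih l (by omega) ((div_left_inj' h0).1 (add_left_cancel h))
        refine ⟨k, hk, ?_⟩
        rw [seg_append, seg_append, pathAct_append, hk',
          ← seg_congr fun i hi => heq i (Nat.lt_succ_of_le hi)]
        congr 1
        -- A removed interval of type 0 is fixed by everything. If it has type 1, the edge just
        -- before it has type 0 and makes the restriction zero.
        rcases hB (x.1 0).rng (x.1 0).src with h0 | h1
        · exact pathAct_seg_of_typ_zero ((hxn a (by omega)).trans h0) _
        · rw [pathRes_seg_of_typ_zero, pathAct_zero]
          rcases hB (x.1 (a + 1)).rng (x.1 (a + 1)).src with h2 | h2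
          · exact h2
          · exact absurd (h2.trans h1.symm) (typ_ne_of_run hxn hxn')

theorem asympEquiv_of_tsum_term_eq (hA : 2 ≤ maxEntry A) (hB : ∀ i j, B i j = 0 ∨ B i j = 1)
    {x y : LeftPath A} (h : ∑' a, term B x a = ∑' a, term B y a) : AsympEquiv A B x y :=
  asympEquiv_iff.2 ⟨1, fun n => exists_pathAct_of_tsum_term_eq hA hB n h⟩

end injectivity

section descent

variable {N : ℕ} {A : Matrix (Fin N) (Fin N) ℕ} {B : Matrix (Fin N) (Fin N) ℤ}

/-! ### `ζ` is constant on asymptotic equivalence classes -/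

/-- A set of vertices from which only edges with `A(e) = 1` of type one lead inside the set, and
which contains every vertex on a cycle of edges with `A(e) = 1` of type one. -/
structure Absorbs (B : Matrix (Fin N) (Fin N) ℤ) (T : Set (Fin N)) : Prop where
  step : ∀ e : Edge A, typ B e = 1 → e.rng ∈ T → A e.rng e.src = 1 ∧ e.src ∈ T
  cycle : ∀ (x : LeftPath A) (i j : ℕ), i < j → (x.1 i).rng = (x.1 j).rng →
    (∀ l, i < l → l ≤ j → typ B (x.1 l) = 1 ∧ sizes x.1 l = 1) → (x.1 i).rng ∈ T

theorem sizes_pos (x : ℕ → Edge A) (i : ℕ) : 1 ≤ sizes x i := (Nat.zero_le _).trans_lt (labels_lt x i)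

theorem radixProd_mono {c : ℕ → ℕ} (h : ∀ i, 1 ≤ c i) : Monotone (radixProd c) :=
  monotone_nat_of_le_succ fun n => by
    rw [radixProd_succ]
    exact Nat.le_mul_of_pos_right _ (h n)

theorem tendsto_radixProd {c : ℕ → ℕ} (h : ∀ i, 1 ≤ c i) (h2 : ∀ n, ∃ i, n ≤ i ∧ 2 ≤ c i) :
    Filter.Tendsto (radixProd c) Filter.atTop Filter.atTop := by
  refine Filter.tendsto_atTop_atTop_of_monotone (radixProd_mono h) fun b => ?_
  induction b with
  | zero => exact ⟨0, Nat.zero_le _⟩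
  | succ b ih =>
    obtain ⟨n, hn⟩ := ih
    obtain ⟨i, hi, hc⟩ := h2 n
    refine ⟨i + 1, ?_⟩
    rw [radixProd_succ]
    have h1 := radixProd_mono h hi
    have h3 : 0 < radixProd c i := Finset.prod_pos fun k _ => h k
    nlinarith

/-- If the product stays bounded, the sizes are eventually 1; by pigeonhole some vertex recurs
arbitrarily far to the left, giving a cycle that meets `T`. Membership in `T` then passes along
edges to every position on the right. -/
theorem Absorbs.dichotomy {T : Set (Fin N)} (hT : Absorbs (A := A) B T) {x : LeftPath A}
    (h1 : ∀ i, typ B (x.1 i) = 1) :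
    (∀ i, sizes x.1 i = 1 ∧ (x.1 i).rng ∈ T) ∨
      Filter.Tendsto (radixProd (sizes x.1)) Filter.atTop Filter.atTop := by
  by_cases hinf : ∀ n, ∃ i, n ≤ i ∧ 2 ≤ sizes x.1 i
  · exact Or.inr (tendsto_radixProd (sizes_pos x.1) hinf)
  · left
    push Not at hinf
    obtain ⟨n, hn⟩ := hinf
    have hn1 : ∀ i, n ≤ i → sizes x.1 i = 1 := fun i hi => by
      have := hn i hi
      have := sizes_pos x.1 i
      omega
    have key : ∀ p, n ≤ p → ∃ i, p ≤ i ∧ (x.1 i).rng ∈ T := by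
      intro p hp
      obtain ⟨a, b, hab, he⟩ := Finite.exists_ne_map_eq_of_infinite fun k => (x.1 (p + k)).rng
      rcases lt_or_gt_of_ne hab with h | h
      · exact ⟨p + a, by omega, hT.cycle x (p + a) (p + b) (by omega) he
          fun l _ _ => ⟨h1 l, hn1 l (by omega)⟩⟩
      · exact ⟨p + b, by omega, hT.cycle x (p + b) (p + a) (by omega) he.symm
          fun l _ _ => ⟨h1 l, hn1 l (by omega)⟩⟩
    have down : ∀ d i, (x.1 (i + d)).rng ∈ T → (x.1 i).rng ∈ T := by
      intro d
      induction d with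
      | zero => exact fun i h => h
      | succ d ih =>
        intro i h
        refine ih i ?_
        rw [← x.2 (i + d)]
        exact (hT.step _ (h1 _) h).2
    intro i
    obtain ⟨j, hj, hjT⟩ := key (n + i) (by omega)
    obtain ⟨d, rfl⟩ := Nat.exists_eq_add_of_le (show i ≤ j by omega)
    have := down d i hjT
    exact ⟨(hT.step _ (h1 i) this).1, this⟩

theorem AsympEquiv.typ_eq {x y : LeftPath A} (h : AsympEquiv A B x y) (i : ℕ) :
    typ B (x.1 i) = typ B (y.1 i) := by
  rw [typ, typ, (h.ends i).1, (h.ends i).2]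

theorem AsympEquiv.run_iff {x y : LeftPath A} (h : AsympEquiv A B x y) (k : ℕ) :
    Run B x k ↔ Run B y k := by
  unfold Run
  simp only [h.typ_eq]

theorem AsympEquiv.start_iff {x y : LeftPath A} (h : AsympEquiv A B x y) (a : ℕ) :
    Start B x a ↔ Start B y a := by
  unfold Start
  simp only [h.typ_eq]

theorem AsympEquiv.runOmega_eq {x y : LeftPath A} (h : AsympEquiv A B x y) :
    runOmega B x = runOmega B y := by
  unfold runOmega
  congr 1
  funext k
  rw [vertexDigit, vertexDigit, (h.ends k).2]
  classical
  exact if_congr (h.run_iff k) rfl rfl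

theorem AsympEquiv.labelBase_eq {x y : LeftPath A} (h : AsympEquiv A B x y) :
    labelBase B x = labelBase B y :=
  labelBase_eq_of_ends h.run_iff fun k _ => h.ends k

theorem AsympEquiv.labelDigit_eq {x y : LeftPath A} (h : AsympEquiv A B x y)
    (he : ∀ k, Run B x (k + 1) → labels x.1 k = labels y.1 k) :
    labelDigit B x = labelDigit B y := by
  funext k
  unfold labelDigit
  by_cases hk : Run B x (k + 1)
  · rw [if_pos hk, if_pos ((h.run_iff _).1 hk)]
    exact he k hk
  · rw [if_neg hk, if_neg fun h' => hk ((h.run_iff _).2 h')]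

/-- Divide the odometer identity by the product P of the sizes: the bounded integer over P tends to
0 and the carry is invisible on the circle, so both phases have the same limit. -/
theorem AsympEquiv.circ_runTheta_of_tendsto {x y : LeftPath A} (h : AsympEquiv A B x y)
    (hx : ∀ k, Run B x k) (h1 : typ B (x.1 0) = 1)
    (ht : Filter.Tendsto (radixProd (sizes x.1)) Filter.atTop Filter.atTop) :
    circ (runTheta B x) = circ (runTheta B y) := by
  obtain ⟨C, hC⟩ := asympEquiv_iff.1 h
  have hlx := labelDigit_lt B x
  have hly := labelDigit_lt B y
  have bx := labelBase_eq_sizes hx h1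
  have dx := labelDigit_eq_labels hx
  have dy := labelDigit_eq_labels fun k => (h.run_iff k).1 (hx k)
  unfold runTheta
  rw [← h.labelBase_eq] at hly ⊢
  have tx := (continuous_circ.tendsto _).comp
    ((tendsto_radix hlx).comp (Filter.tendsto_add_atTop_nat 1))
  have ty := (continuous_circ.tendsto _).comp
    ((tendsto_radix hly).comp (Filter.tendsto_add_atTop_nat 1))
  rw [bx, dx, dy] at *
  have hq : ∀ n, ∃ k : ℤ, k.natAbs ≤ C ∧ ∃ q : ℤ,
      (radixVal (labels x.1) (sizes x.1) (n + 1) : ℤ) + k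
        = radixVal (labels y.1) (sizes x.1) (n + 1) + radixProd (sizes x.1) (n + 1) * q := by
    intro n
    obtain ⟨k, hk, hk'⟩ := hC n
    exact ⟨k, hk, radixVal_of_pathAct (fun i _ => (hx (i + 1) i (by omega)).trans h1) hk'⟩
  choose k hk q hkq using hq
  have hP : Filter.Tendsto (fun n => (radixProd (sizes x.1) (n + 1) : ℝ)) Filter.atTop
      Filter.atTop :=
    tendsto_natCast_atTop_atTop.comp (ht.comp (Filter.tendsto_add_atTop_nat 1))
  have hz : Filter.Tendsto (fun n => (k n : ℝ) / radixProd (sizes x.1) (n + 1)) Filter.atTop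
      (nhds 0) := by
    refine squeeze_zero_norm (fun n => ?_) (hP.const_div_atTop (C : ℝ))
    rw [norm_div, Real.norm_natCast, Real.norm_eq_abs, ← Int.cast_abs]
    have h3 : |k n| ≤ C := by
      rw [Int.abs_eq_natAbs]
      exact_mod_cast hk n
    have h4 : ((|k n| : ℤ) : ℝ) ≤ C := by exact_mod_cast h3
    gcongr
  have hz' := (continuous_circ.tendsto _).comp hz
  have h0 : circ 0 = 1 := by simp [circ]
  rw [h0] at hz'
  have hm := tx.mul hz'
  rw [mul_one] at hm
  refine tendsto_nhds_unique (hm.congr fun n => ?_) ty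
  have hp : (radixProd (sizes x.1) (n + 1) : ℝ) ≠ 0 := by
    exact_mod_cast (radixProd_pos (labels_lt x.1) (n + 1)).ne'
  simp only [Function.comp]
  rw [← circ_add, circ_eq_iff]
  refine ⟨q n, ?_⟩
  have h5 : (radixVal (labels x.1) (sizes x.1) (n + 1) : ℝ) + k n
      = radixVal (labels y.1) (sizes x.1) (n + 1) + radixProd (sizes x.1) (n + 1) * q n := by
    exact_mod_cast hkq n
  field_simp
  linarith

/-- Only an infinite interval of type 1 allows the labels to differ: a finite one of type 1 is
preceded on the left by an edge of type 0, which forces agreement to its right. -/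
theorem AsympEquiv.circ_runTheta_eq {T : Set (Fin N)} (hT : Absorbs (A := A) B T)
    (hB : ∀ i j, B i j = 0 ∨ B i j = 1) {x y : LeftPath A} (h : AsympEquiv A B x y) :
    circ (runTheta B x) = circ (runTheta B y) := by
  have done : (∀ k, Run B x (k + 1) → labels x.1 k = labels y.1 k) →
      circ (runTheta B x) = circ (runTheta B y) := fun he => by
    rw [runTheta, runTheta, h.labelDigit_eq he, h.labelBase_eq]
  have done' : (∀ k, Run B x (k + 1) → x.1 k = y.1 k) →
      circ (runTheta B x) = circ (runTheta B y) := fun he => done fun k hk => by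
    rw [labels, labels, he k hk]
  rcases hB (x.1 0).rng (x.1 0).src with h0 | h1
  · exact done' fun k hk => h.eq_of_typ_zero ((hk k (by omega)).trans h0) k le_rfl
  · by_cases hx : ∀ k, Run B x k
    · rcases hT.dichotomy fun i => (hx (i + 1) i (by omega)).trans h1 with h2 | h2
      · refine done fun k _ => ?_
        have e : sizes y.1 k = sizes x.1 k := by
          rw [sizes, sizes, (h.ends k).1, (h.ends k).2]
        have := labels_lt x.1 k
        have := labels_lt y.1 k
        have := (h2 k).1
        omega
      · exact h.circ_runTheta_of_tendsto hx h1 h2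
    · obtain ⟨n, hn, hxn, hxn'⟩ := exists_run_length hx
      refine done' fun k hk => ?_
      have hkn : k ≤ n := by
        by_contra! hlt
        exact hxn' (hk.mono (by omega))
      refine h.eq_of_typ_zero (j := n) ?_ k hkn
      rcases hB (x.1 n).rng (x.1 n).src with h2 | h2
      · exact h2
      · exact absurd (h2.trans h1.symm) (typ_ne_of_run hxn hxn')

theorem AsympEquiv.tsum_term_eq {T : Set (Fin N)} (hT : Absorbs (A := A) B T)
    (hB : ∀ i j, B i j = 0 ∨ B i j = 1) {x y : LeftPath A} (h : AsympEquiv A B x y) :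
    ∑' a, term B x a = ∑' a, term B y a := by
  refine tsum_congr fun a => ?_
  have h' := h.shift a
  rw [term, term, runTerm, runTerm, h'.runOmega_eq, h'.circ_runTheta_eq hT hB]
  classical
  exact if_congr (h.start_iff a) rfl rfl

/-! ### Continuity -/

theorem eventually_agree (x : LeftPath A) (n : ℕ) :
    ∀ᶠ y in nhds x, ∀ i < n, y.1 i = x.1 i := by
  have : DiscreteTopology (Edge A) := ⟨rfl⟩
  refine (Set.finite_lt_nat n).eventually_all.2 fun i _ => ?_
  have hc : Continuous fun y : LeftPath A => y.1 i := (continuous_apply i).comp continuous_subtype_val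
  exact hc.continuousAt.eventually (p := fun e => e = x.1 i) (mem_nhds_discrete.2 rfl)

theorem continuous_of_agree {X : Type*} [TopologicalSpace X] {f : LeftPath A → X} (n : ℕ)
    (h : ∀ x y : LeftPath A, (∀ i < n, y.1 i = x.1 i) → f y = f x) : Continuous f :=
  continuous_iff_continuousAt.2 fun x => by
    refine (continuousAt_const (y := f x)).congr ?_
    filter_upwards [eventually_agree x n] with y hy
    exact (h x y hy).symm

theorem run_iff_of_agree {x y : LeftPath A} {n k : ℕ} (hk : k ≤ n) (h0 : 0 < n)
    (h : ∀ i < n, y.1 i = x.1 i) : Run B y k ↔ Run B x k := by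
  unfold Run
  refine forall₂_congr fun i hi => ?_
  rw [h i (by omega), h 0 h0]

theorem continuous_shift (a : ℕ) : Continuous fun x : LeftPath A => shift x a :=
  continuous_induced_rng.2 (continuous_pi fun k => (continuous_apply (a + k)).comp
    continuous_subtype_val)

theorem continuous_digitSum {R : ℝ} (hR : 1 < R) {n : ℕ} {d : LeftPath A → ℕ → ℕ}
    (hd : ∀ x k, d x k ≤ n) (hc : ∀ k, Continuous fun x => d x k) :
    Continuous fun x => digitSum R (d x) := by
  unfold digitSum
  refine continuous_tsum (fun k => ?_) (summable_const_div_pow hR (n : ℝ)) fun k x => ?_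
  · exact (continuous_of_discreteTopology.comp (hc k)).div_const _
  · have := hd x k
    rw [norm_div, Real.norm_natCast, norm_pow, Real.norm_of_nonneg (by linarith)]
    gcongr

theorem continuous_runOmega (hA : 2 ≤ maxEntry A) : Continuous (runOmega (A := A) B) := by
  refine continuous_digitSum ?_ (vertexDigit_le B) fun k => continuous_of_agree (k + 1) ?_
  · have := bigR_ge hA
    have hn : (0 : ℝ) ≤ N := by positivity
    linarith
  · intro x y h
    rw [vertexDigit, vertexDigit, h k (Nat.lt_succ_self k)]
    classical
    exact if_congr (run_iff_of_agree (Nat.le_succ k) (Nat.succ_pos k) h) rfl rfl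

theorem labels_of_agree {x y : LeftPath A} {n k : ℕ} (hk : k < n) (h : ∀ i < n, y.1 i = x.1 i) :
    labelDigit B y k = labelDigit B x k ∧ labelBase B y k = labelBase B x k := by
  have hr := run_iff_of_agree (B := B) (Nat.succ_le_of_lt hk) (by omega) h
  rw [labelDigit, labelDigit, labelBase, labelBase, h k hk]
  classical
  exact ⟨if_congr hr rfl rfl, if_congr hr rfl rfl⟩

theorem tendsto_labelBase (hT : Absorbs (A := A) B ∅) (hB : ∀ i j, B i j = 0 ∨ B i j = 1)
    {x : LeftPath A} (hx : ∀ k, Run B x k) :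
    Filter.Tendsto (radixProd (labelBase B x)) Filter.atTop Filter.atTop := by
  rcases hB (x.1 0).rng (x.1 0).src with h0 | h1
  · have h2 : ∀ k, 2 ≤ labelBase B x k := fun k => by
      have h1 : typ B (x.1 k) = 0 := (hx (k + 1) k (by omega)).trans h0
      have := (x.1 k).num.isLt
      rw [labelBase, if_pos (hx _), base, if_neg (by rw [h1]; decide)]
      omega
    exact tendsto_radixProd (fun k => (by norm_num : 1 ≤ 2).trans (h2 k)) fun n => ⟨n, le_rfl, h2 n⟩
  · rw [labelBase_eq_sizes hx h1]
    rcases hT.dichotomy fun i => (hx (i + 1) i (by omega)).trans h1 with h2 | h2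
    · exact absurd (h2 0).2 (Set.notMem_empty _)
    · exact h2

/-- On an infinite run, agreement in the last n edges confines both values to one interval of length
1/P, with P the product of n bases, and P tends to infinity because `T` is empty. A finite run is
determined by finitely many edges, so θ is locally constant there. -/
theorem continuous_runTheta (hT : Absorbs (A := A) B ∅) (hB : ∀ i j, B i j = 0 ∨ B i j = 1) :
    Continuous (runTheta (A := A) B) := by
  refine continuous_iff_continuousAt.2 fun x => ?_
  by_cases hx : ∀ k, Run B x k
  · refine Metric.continuousAt_iff'.2 fun ε hε => ?_
    have h1 : Filter.Tendsto (fun n => (radixProd (labelBase B x) n : ℝ)) Filter.atTop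
        Filter.atTop := tendsto_natCast_atTop_atTop.comp (tendsto_labelBase hT hB hx)
    obtain ⟨n, hn⟩ := (h1.eventually_gt_atTop (1 / ε)).exists
    filter_upwards [eventually_agree x n] with y hy
    have bx := radixSum_bounds (labelDigit_lt B x) n
    have bY := radixSum_bounds (labelDigit_lt B y) n
    rw [radixVal_congr (fun k hk => (labels_of_agree hk hy).1)
      (fun k hk => (labels_of_agree hk hy).2),
      radixProd_congr fun k hk => (labels_of_agree hk hy).2] at bY
    have hp : (0 : ℝ) < radixProd (labelBase B x) n := by
      exact_mod_cast radixProd_pos (labelDigit_lt B x) n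
    rw [div_lt_iff₀ hε] at hn
    rw [Real.dist_eq, abs_lt]
    unfold runTheta
    constructor <;> nlinarith
  · obtain ⟨n, hn, hxn, hxn'⟩ := exists_run_length hx
    refine (continuousAt_const (y := runTheta B x)).congr ?_
    filter_upwards [eventually_agree x (n + 1)] with y hy
    have hyn' : ¬ Run B y (n + 1) := fun h => hxn' ((run_iff_of_agree le_rfl (by omega) hy).1 h)
    rw [runTheta, runTheta, radixSum_of_finite (labelDigit_lt B x) (labelDigit_eq_zero hxn'),
      radixSum_of_finite (labelDigit_lt B y) (labelDigit_eq_zero hyn'),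
      radixVal_congr (fun k hk => (labels_of_agree (by omega) hy).1)
      (fun k hk => (labels_of_agree (by omega) hy).2),
      radixProd_congr fun k hk => (labels_of_agree (by omega) hy).2]

theorem continuous_tsum_term (hA : 2 ≤ maxEntry A) (hT : Absorbs (A := A) B ∅)
    (hB : ∀ i j, B i j = 0 ∨ B i j = 1) :
    Continuous fun x : LeftPath A => ∑' a, term B x a := by
  rcases isEmpty_or_nonempty (LeftPath A) with he | ⟨⟨x₀⟩⟩
  · exact continuous_of_const fun x => (he.false x).elim
  -- The path `x₀` only guarantees N ≥ 1, hence R ≥ 4; the bound itself is uniform in the path.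
  refine continuous_tsum (fun a => ?_) (summable_bound hA x₀) fun a x => norm_term_le hA x a
  refine continuous_iff_continuousAt.2 fun x => ?_
  have hc : Continuous fun x : LeftPath A =>
      runTerm B (shift x a) / (bigR A : ℂ) ^ (3 * (a + 1)) := by
    refine Continuous.div_const (Continuous.mul ?_ ?_) _
    · exact Complex.continuous_ofReal.comp ((continuous_runOmega hA).comp (continuous_shift a))
    · exact continuous_circ.comp ((continuous_runTheta hT hB).comp (continuous_shift a))
  have hs : ∀ᶠ y in nhds x, Start B y a ↔ Start B x a := by
    filter_upwards [eventually_agree x (a + 1)] with y hy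
    refine forall₂_congr fun k hk => ?_
    rw [hy k (by omega), hy a (by omega)]
  by_cases h : Start B x a
  · refine hc.continuousAt.congr ?_
    filter_upwards [hs] with y hy
    rw [term, if_pos (hy.2 h)]
  · refine (continuousAt_const (y := (0 : ℂ))).congr ?_
    filter_upwards [hs] with y hy
    rw [term, if_neg fun h' => h (hy.1 h')]

end descent

section regularity

variable {N : ℕ} {A : Matrix (Fin N) (Fin N) ℕ} {B : Matrix (Fin N) (Fin N) ℤ}

/-! ### Vertices with trivial generator -/

theorem gen_eq_one_iff {v : Fin N} :
    gen A B v = 1 ↔ ∀ q : List (Edge A), IsPathFrom v q → pathAct A B 1 q = q := by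
  refine (mk_eq_mk_iff (v := v) (Multiplicative.ofAdd 1) 1).trans ?_
  simp only [toAdd_ofAdd, toAdd_one, pathAct_zero]

theorem pathAct_of_gen_eq_one {v : Fin N} (h : gen A B v = 1) (k : ℤ) {q : List (Edge A)}
    (hq : IsPathFrom v q) : pathAct A B k q = q := by
  have h1 : (QuotientGroup.mk (Multiplicative.ofAdd k) : GB A B v)
      = QuotientGroup.mk (1 : Multiplicative ℤ) := by
    have e : (QuotientGroup.mk (Multiplicative.ofAdd k) : GB A B v) = gen A B v ^ k := by
      rw [gen, ← QuotientGroup.mk_zpow, ← ofAdd_zsmul, smul_eq_mul, mul_one]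
    rw [e, h, one_zpow]
    rfl
  have := (mk_eq_mk_iff (v := v) _ _).1 h1 q hq
  rwa [toAdd_ofAdd, toAdd_one, pathAct_zero] at this

/-- Fixing the label m means 1 + m = qA + m, so qA = 1. Hence A = q = 1, and the restriction is
again the generator, which must act trivially as well. -/
theorem edge_of_gen_eq_one {e : Edge A} (h1 : typ B e = 1) (h : gen A B e.rng = 1) :
    A e.rng e.src = 1 ∧ gen A B e.src = 1 := by
  rw [gen_eq_one_iff] at h
  have he : edgeAct A B 1 e = e := by
    simpa [pathAct] using h [e] ⟨rfl, trivial⟩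
  have hm := edge_div_mod h1 1
  rw [he] at hm
  have hm' : edgeRes A B 1 e * (A e.rng e.src : ℤ) = 1 := by linarith
  have hA : A e.rng e.src = 1 := by
    have := Int.eq_one_or_neg_one_of_mul_eq_one ((mul_comm _ _).trans hm')
    omega
  refine ⟨hA, gen_eq_one_iff.2 fun q hq => ?_⟩
  have hr : edgeRes A B 1 e = 1 := by simpa [hA] using hm'
  have := h (e :: q) ⟨rfl, hq⟩
  simp only [pathAct, hr, List.cons.injEq] at this
  exact this.2

/-- The path `p` repeated `n` times. -/
def repeatPath (p : List (Edge A)) : ℕ → List (Edge A)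
  | 0 => []
  | n + 1 => p ++ repeatPath p n

theorem srcOf_append (p q : List (Edge A)) : ∀ v, srcOf v (p ++ q) = srcOf (srcOf v p) q := by
  induction p with
  | nil => exact fun v => rfl
  | cons e p ih => exact fun v => ih e.src

theorem pathRes_append (p q : List (Edge A)) : ∀ k,
    pathRes A B k (p ++ q) = pathRes A B (pathRes A B k p) q := by
  induction p with
  | nil => exact fun k => rfl
  | cons e p ih => exact fun k => ih _

theorem repeatPath_spec {p : List (Edge A)} {v : Fin N} (hp : IsPathFrom v p) (hs : srcOf v p = v)
    (ha : pathAct A B 1 p = p) (hr : pathRes A B 1 p = 1) (n : ℕ) :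
    IsPathFrom v (repeatPath p n) ∧ srcOf v (repeatPath p n) = v ∧
      pathAct A B 1 (repeatPath p n) = repeatPath p n ∧ pathRes A B 1 (repeatPath p n) = 1 := by
  induction n with
  | zero => exact ⟨trivial, rfl, rfl, rfl⟩
  | succ n ih =>
    obtain ⟨h1, h2, h3, h4⟩ := ih
    refine ⟨isPathFrom_append _ _ _ hp (by rwa [hs]), ?_, ?_, ?_⟩
    · rw [repeatPath, srcOf_append, hs, h2]
    · rw [repeatPath, pathAct_append, hr, ha, h3]
    · rw [repeatPath, pathRes_append, hr, h4]

theorem le_length_repeatPath {p : List (Edge A)} (hp : p ≠ []) (n : ℕ) :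
    n ≤ (repeatPath p n).length := by
  induction n with
  | zero => exact Nat.zero_le _
  | succ n ih =>
    have := List.length_pos_iff.2 hp
    rw [repeatPath, List.length_append]
    omega

/-- Repeated often enough, the cycle is a fixed path as long as regularity demands, and the
restriction to it is still the generator, which is therefore the unit. -/
theorem IsRegular.gen_eq_one_of_cycle (hreg : IsRegular A B) {p : List (Edge A)} {v : Fin N}
    (h0 : p ≠ []) (hp : IsPathFrom v p) (hs : srcOf v p = v) (ha : pathAct A B 1 p = p)
    (hr : pathRes A B 1 p = 1) : gen A B v = 1 := by
  obtain ⟨K, hK⟩ := hreg v (gen A B v)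
  obtain ⟨h1, h2, h3, h4⟩ := repeatPath_spec hp hs ha hr K
  have h5 := hK ⟨repeatPath p K, h1⟩ (Subtype.ext h3) (le_length_repeatPath h0 K)
  have h6 := (mk_eq_mk_iff (v := srcOf v (repeatPath p K)) (Multiplicative.ofAdd
    (pathRes A B 1 (repeatPath p K))) 1).1 h5
  rw [h2] at h6
  simpa only [toAdd_ofAdd, toAdd_one, pathAct_zero, h4, ← gen_eq_one_iff] using h6

theorem srcOf_seg (x : ℕ → Edge A) (n : ℕ) (v : Fin N) : srcOf v (seg x n) = (x 0).src := by
  induction n generalizing v with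
  | zero => rfl
  | succ n ih => exact ih _

theorem pathAct_one_seg {x : ℕ → Edge A} {n : ℕ} (h : ∀ l ≤ n, typ B (x l) = 1 ∧ sizes x l = 1) :
    pathAct A B 1 (seg x n) = seg x n ∧ pathRes A B 1 (seg x n) = 1 := by
  have key : ∀ l ≤ n, edgeAct A B 1 (x l) = x l ∧ edgeRes A B 1 (x l) = 1 := fun l hl => by
    have hA : A (x l).rng (x l).src = 1 := (h l hl).2
    refine edgeAct_eq_of_mod (h l hl).1 rfl rfl ?_
    have hA' : (A (x l).rng (x l).src : ℤ) = 1 := by exact_mod_cast hA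
    linear_combination -hA'
  induction n with
  | zero =>
    rw [seg, pathAct, pathAct, pathRes, pathRes, (key 0 le_rfl).1]
    exact ⟨rfl, (key 0 le_rfl).2⟩
  | succ n ih =>
    obtain ⟨h1, h2⟩ := ih (fun l hl => h l (by omega)) fun l hl => key l (by omega)
    rw [seg, pathAct, pathRes, (key _ le_rfl).1, (key _ le_rfl).2, h1]
    exact ⟨rfl, h2⟩

theorem IsRegular.absorbs (hreg : IsRegular A B) :
    Absorbs (A := A) B {v | gen A B v = 1} where
  step _ h1 h := edge_of_gen_eq_one h1 h
  cycle x i j hij he h := by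
    -- The cycle consists of the edges at positions i + 1, …, j; its source is the source of edge i
    -- + 1, which is the range of edge i.
    obtain ⟨d, rfl⟩ := Nat.exists_eq_add_of_le (Nat.succ_le_of_lt hij)
    obtain ⟨ha, hr⟩ := pathAct_one_seg (B := B) (x := (shift x (i + 1)).1) (n := d)
      fun l hl => h (i + 1 + l) (by omega) (by omega)
    refine hreg.gen_eq_one_of_cycle (seg_ne_nil _ _) ?_ ?_ ha hr
    · rw [he]
      exact isPathFrom_seg (shift x (i + 1)) d
    · rw [srcOf_seg]
      exact x.2 i

/-! ### The reduced matrix -/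

theorem reduced_of_gen_eq_one {i : Fin N} (h : gen A B i = 1) (j : Fin N) :
    reduced A B i j = 0 := if_pos h

theorem reduced_of_gen_ne_one {i : Fin N} (h : gen A B i ≠ 1) (j : Fin N) :
    reduced A B i j = B i j := if_neg h

theorem reduced_zero_or_one (hB : ∀ i j, B i j = 0 ∨ B i j = 1) (i j : Fin N) :
    reduced A B i j = 0 ∨ reduced A B i j = 1 := by
  by_cases h : gen A B i = 1
  · exact Or.inl (reduced_of_gen_eq_one h j)
  · rw [reduced_of_gen_ne_one h]
    exact hB i j

theorem reduced_eq (hB : ∀ i j, B i j = 0 ∨ B i j = 1) (h : ∀ i j, B i j = 1 → gen A B i ≠ 1) :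
    reduced A B = B := by
  ext i j
  by_cases hg : gen A B i = 1
  · rw [reduced_of_gen_eq_one hg]
    exact ((hB i j).resolve_right fun h1 => h i j h1 hg).symm
  · exact reduced_of_gen_ne_one hg j

theorem pathAct_reduced (q : List (Edge A)) : ∀ (v : Fin N) (k : ℤ), IsPathFrom v q →
    pathAct A (reduced A B) k q = pathAct A B k q := by
  induction q with
  | nil => exact fun _ _ _ => rfl
  | cons e q ih =>
    rintro v k ⟨rfl, hq⟩
    by_cases hg : gen A B e.rng = 1
    · have h0 : typ (reduced A B) e = 0 := reduced_of_gen_eq_one hg _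
      rw [pathAct_of_gen_eq_one hg k (q := e :: q) ⟨rfl, hq⟩, pathAct, edgeAct_of_typ_zero h0,
        edgeRes_of_typ_zero h0, pathAct_zero]
    · have h0 := reduced_of_gen_ne_one hg e.src
      have ha : edgeAct A (reduced A B) k e = edgeAct A B k e := by simp only [edgeAct, h0]
      have hr : edgeRes A (reduced A B) k e = edgeRes A B k e := by simp only [edgeRes, h0]
      rw [pathAct, pathAct, ha, hr, ih _ _ hq]

theorem asympEquiv_reduced_iff {x y : LeftPath A} :
    AsympEquiv A (reduced A B) x y ↔ AsympEquiv A B x y := by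
  rw [asympEquiv_iff, asympEquiv_iff]
  simp only [pathAct_reduced _ _ _ (isPathFrom_seg x _)]

/-- Type 1 for the reduced matrix excludes trivial generators at the ranges on the cycle, while
regularity would make them trivial; so no such cycle exists. -/
theorem IsRegular.absorbs_reduced (hreg : IsRegular A B) :
    Absorbs (A := A) (reduced A B) ∅ where
  step _ _ h := absurd h (Set.notMem_empty _)
  cycle x i j hij he h := by
    have hne : ∀ l, i < l → l ≤ j → gen A B (x.1 l).rng ≠ 1 := fun l hl hl' hg => by
      have h1 : reduced A B (x.1 l).rng (x.1 l).src = 1 := (h l hl hl').1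
      rw [reduced_of_gen_eq_one hg] at h1
      exact zero_ne_one h1
    have hT := hreg.absorbs.cycle x i j hij he fun l hl hl' =>
      ⟨(reduced_of_gen_ne_one (hne l hl hl') _).symm.trans (h l hl hl').1, (h l hl hl').2⟩
    rw [he] at hT
    exact absurd hT (hne j hij le_rfl)

/-! ### The embeddings of the limit space -/

theorem zeta_eq_iff {T : Set (Fin N)} (hA : 2 ≤ maxEntry A) (hB : ∀ i j, B i j = 0 ∨ B i j = 1)
    (hT : Absorbs (A := A) B T) (x y : LeftPath A) :
    zeta A B x = zeta A B y ↔ AsympEquiv A B x y := by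
  rw [zeta_eq hA hB, zeta_eq hA hB]
  exact ⟨asympEquiv_of_tsum_term_eq hA hB, fun h => h.tsum_term_eq hT hB⟩

theorem IsRegular.exists_zeta_reduced (hreg : IsRegular A B) (hA : 2 ≤ maxEntry A)
    (hB : ∀ i j, B i j = 0 ∨ B i j = 1) :
    ∃ f : LimitSpace A B → ℂ, Continuous f ∧ Function.Injective f ∧
      ∀ x : LeftPath A, f (Quotient.mk (aeSetoid A B) x) = zeta A (reduced A B) x := by
  have hB' := reduced_zero_or_one (A := A) hB
  have hT := hreg.absorbs_reduced
  have key : ∀ x y : LeftPath A, zeta A (reduced A B) x = zeta A (reduced A B) y ↔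
      AsympEquiv A B x y := fun x y =>
    (zeta_eq_iff hA hB' hT x y).trans asympEquiv_reduced_iff
  have hc : Continuous (zeta A (reduced A B)) := by
    rw [funext (zeta_eq hA hB')]
    exact continuous_tsum_term hA hT hB'
  refine ⟨Quotient.lift (zeta A (reduced A B)) fun x y h => (key x y).2 h,
    hc.quotient_lift _, ?_, fun x => rfl⟩
  rintro ⟨x⟩ ⟨y⟩ h
  exact Quotient.sound ((key x y).1 h)

/-! ### The case M ≤ 1 -/

theorem eq_of_maxEntry_le_one (hA : maxEntry A ≤ 1) {x y : LeftPath A}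
    (h : ∀ i, (x.1 i).rng = (y.1 i).rng ∧ (x.1 i).src = (y.1 i).src) : x = y := by
  have h0 : ∀ (z : LeftPath A) (i : ℕ), ((z.1 i).num : ℕ) = 0 := fun z i => by
    have h1 : A (z.1 i).rng (z.1 i).src ≤ maxEntry A :=
      Finset.le_sup (f := fun ij : Fin N × Fin N => A ij.1 ij.2)
        (Finset.mem_univ ((z.1 i).rng, (z.1 i).src))
    have := (z.1 i).num.isLt
    omega
  refine Subtype.ext (funext fun i => Edge.eq_of_num (h i).1 (h i).2 ?_)
  rw [h0, h0]

theorem exists_embedding_of_maxEntry_le_one (hA : maxEntry A ≤ 1) :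
    ∃ f : LimitSpace A B → ℂ, Continuous f ∧ Function.Injective f := by
  have hd : ∀ (x : LeftPath A) (k : ℕ), ((x.1 k).src : ℕ) + 1 ≤ N := fun x k => (x.1 k).src.isLt
  -- The base 2(N + 1) replaces R = M(N + 1), which is too small for `digitSum_injective` when M ≤
  -- 1.
  have hR : 1 < 2 * ((N : ℝ) + 1) := by
    have : (0 : ℝ) ≤ N := by positivity
    linarith
  have hc : Continuous fun x : LeftPath A =>
      ((digitSum (2 * ((N : ℝ) + 1)) fun k => ((x.1 k).src : ℕ) + 1 : ℝ) : ℂ) :=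
    Complex.continuous_ofReal.comp <| continuous_digitSum hR hd fun k =>
      continuous_of_agree (k + 1) fun x y h => by rw [h k (Nat.lt_succ_self k)]
  refine ⟨Quotient.lift _ fun x y h => ?_, hc.quotient_lift _, ?_⟩
  · rw [eq_of_maxEntry_le_one hA fun i => AsympEquiv.ends h i]
  · rintro ⟨x⟩ ⟨y⟩ h
    have h1 := digitSum_injective le_rfl (hd x) (hd y) (Complex.ofReal_injective h)
    have hs : ∀ k, (x.1 k).src = (y.1 k).src := fun k => by
      have := congrFun h1 k
      exact Fin.ext (by omega)
    refine congrArg _ (eq_of_maxEntry_le_one hA fun i => ⟨?_, hs i⟩)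
    rw [← x.2 i, ← y.2 i, hs]

end regularity

end KEP

end

theorem mainTheorem9 (N : ℕ) (A : Matrix (Fin N) (Fin N) ℕ) (B : Matrix (Fin N) (Fin N) ℤ)
    (hAB : ∀ i j, A i j = 0 → B i j = 0) (hB : ∀ i j, B i j = 0 ∨ B i j = 1)
    (hreg : KEP.IsRegular A B) :
    (∃ f : KEP.LimitSpace A B → ℂ, Continuous f ∧ Function.Injective f) ∧
    (2 ≤ KEP.maxEntry A →
      (∀ μ ν : KEP.LeftPath A, KEP.zeta A B μ = KEP.zeta A B ν ↔ KEP.AsympEquiv A B μ ν) ∧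
      (∃ f : KEP.LimitSpace A B → ℂ, Continuous f ∧ Function.Injective f ∧
        ∀ μ : KEP.LeftPath A,
          f (Quotient.mk (KEP.aeSetoid A B) μ) = KEP.zeta A (KEP.reduced A B) μ) ∧
      ((∀ i j, B i j = 1 → KEP.gen A B i ≠ 1) →
        ∃ f : KEP.LimitSpace A B → ℂ, Continuous f ∧ Function.Injective f ∧
          ∀ μ : KEP.LeftPath A, f (Quotient.mk (KEP.aeSetoid A B) μ) = KEP.zeta A B μ)) := by
  refine ⟨?_, fun hA => ⟨KEP.zeta_eq_iff hA hB hreg.absorbs, hreg.exists_zeta_reduced hA hB,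
    fun h => ?_⟩⟩
  · rcases le_or_gt (KEP.maxEntry A) 1 with hA | hA
    · exact KEP.exists_embedding_of_maxEntry_le_one hA
    · obtain ⟨f, hf, hi, -⟩ := hreg.exists_zeta_reduced hA hB
      exact ⟨f, hf, hi⟩
  · obtain ⟨f, hf, hi, he⟩ := hreg.exists_zeta_reduced hA hB
    rw [KEP.reduced_eq hB h] at he
    exact ⟨f, hf, hi, he⟩
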